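/- Let $d\ge 2$ and, for $A=(A_0,\dots,A_{d-2})\in\mathbb C^{d-1}$ with $A_r=\alpha_r+i\beta_r$, let $P_A(z)=z^d+\sum_{r=0}^{d-2}A_r z^r$. Let $J_P$ be the Julia set of $P$, i.e. the boundary of the set of points whose orbit does not tend to infinity. Call $P$ hyperbolic if there are $C>0$ and $\lambda>1$ with $|(P^n)'(z)|\ge C\lambda^n$ for all $z\in J_P$ and $n\ge1$. Let $H_d$ be the set of all $A$ such that $\alpha_r^2+\beta_r^2<1$ for $0\le r\le d-2$, $P_A$ is hyperbolic, and all critical points of $P_A$ in $\mathbb C$ have bounded orbits. For $P=P_A$ with $A\in H_d$, let $\Psi_P:\{|w|\ge1\}\to\mathbb C$ be the inverse of the Böttcher coordinate at infinity extended continuously to the unit circle, i.e. the unique continuous map with $\Psi_P(w^d)=P(\Psi_P(w))$ and $\Psi_P(w)/w\to1$ as $w\to\infty$. Its restriction to the unit circle semiconjugates $z\mapsto z^d$ to $P|_{J_P}$ (it is a homeomorphism onto $J_P$ if $J_P$ is a Jordan curve). The $j$-th preimage branch of $P$ $(0\le j<d)$ sends the point $\Psi_P(e^{2\pi i\theta})$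 of angle $\theta\in[0,1)$ to the point of angle $(\theta+j)/d$; for a word $\eta\in\{0,\dots,d-1\}^n$ let $\theta_\eta$ be the angle obtained from $\theta$ by applying the branches $\eta_1,\dots,\eta_n$ in this order. For a probability vector $p=(p_0,\dots,p_{d-1})$ with all $p_j>0$, the weighted Lyubich measure $\mu_p$ of $P$ is the weak limit, for every starting angle $\theta\in[0,1)$ and independently of it, of $$\sum_{\eta\in\{0,\dots,d-1\}^n}p_{\eta_1}\cdots p_{\eta_n}\,\delta_{\Psi_P(e^{2\pi i\theta_\eta})}\qquad(n\to\infty),$$ and the Lyapunov exponent is $$\Lambda_{\mu_p}(P)=-\int_{J_P}\log|P'|\,d\mu_p .$$ Then $H_d$ is open; for every $A\in H_d$ the measure $\mu_p$ exists, is unique and is carried by $J_{P_A}$, and $\log|P_A'|$ is $\mu_p$-integrable on $J_{P_A}$; the function $A\mapsto\Lambda_{\mu_p}(P_A)$ is twice continuously differentiable (in the real sense) on $H_d$; and, for every strictly positive probability vector $p$, at every point of $H_d$, $$\frac{\partial^2\Lambda_{\mu_p}}{\partial\alpha_r\,\partial\alpha_s}=-\frac{\partial^2\Lambda_{\mu_p}}{\partial\beta_r\,\partial\beta_s}\qquad\text{for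 all }0\le r,s\le d-2 .$$ -/

import Mathlib

open Filter Topology MeasureTheory Set

/-- The monic centred polynomial `z ^ d + A_{d-2} z ^ (d-2) + ⋯ + A_1 z + A_0`; the index set
`Fin (d - 1)` of the coefficients is `{0, …, d - 2}`. -/
noncomputable def centredPoly (d : ℕ) (A : Fin (d - 1) → ℂ) : Polynomial ℂ :=
  Polynomial.X ^ d + ∑ r : Fin (d - 1), Polynomial.C (A r) * Polynomial.X ^ (r : ℕ)

/-- The `n`-th iterate of the polynomial map `z ↦ P z`. -/
noncomputable def polyIter (P : Polynomial ℂ) (n : ℕ) : ℂ → ℂ :=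
  (fun z => P.eval z)^[n]

/-- The basin of attraction of infinity. -/
def basinInfinity (P : Polynomial ℂ) : Set ℂ :=
  {z | Tendsto (fun n => polyIter P n z) atTop (Bornology.cobounded ℂ)}

/-- The filled Julia set: the points whose orbit does not tend to infinity. -/
def filledJulia (P : Polynomial ℂ) : Set ℂ := (basinInfinity P)ᶜ

/-- The Julia set: the common boundary of the filled Julia set and the basin of infinity. -/
def juliaSet (P : Polynomial ℂ) : Set ℂ := frontier (filledJulia P)

/-- Hyperbolicity: `P` is uniformly expanding on its Julia set. -/
def IsHyperbolicPoly (P : Polynomial ℂ) : Prop :=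
  ∃ C : ℝ, 0 < C ∧ ∃ lam : ℝ, 1 < lam ∧
    ∀ z ∈ juliaSet P, ∀ n : ℕ, 1 ≤ n → C * lam ^ n ≤ ‖deriv (polyIter P n) z‖

/-- All the critical points of `P` (in the plane) have a bounded orbit. -/
def HasBoundedCriticalOrbits (P : Polynomial ℂ) : Prop :=
  ∀ c : ℂ, P.derivative.eval c = 0 → Bornology.IsBounded (range fun n => polyIter P n c)

/-- The parameter space: the coefficient vectors with all entries of modulus less than one, for
which the polynomial is hyperbolic and has bounded critical orbits. -/
def paramSpace (d : ℕ) : Set (Fin (d - 1) → ℂ) :=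
  {A | (∀ r, (A r).re ^ 2 + (A r).im ^ 2 < 1) ∧ IsHyperbolicPoly (centredPoly d A) ∧
    HasBoundedCriticalOrbits (centredPoly d A)}

/-- `Psi` is the inverse Böttcher coordinate at infinity of the monic polynomial `P` of degree `d`,
together with its continuous extension to the unit circle: it is continuous on `1 ≤ |w|`, conjugates
`w ↦ w ^ d` to `P`, and is tangent to the identity at infinity. When the critical orbits of `P`
are bounded, at most one function on `1 ≤ |w|` has these properties. Its restriction to the unit
circle is the normalised (semi-)conjugacy from `z ^ d` on the circle to `P` on the Julia set
(a homeomorphism if the Julia set is a Jordan curve); for `P = z ^ d` it is the identity. -/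
structure IsBoettcherParam (d : ℕ) (P : Polynomial ℂ) (Psi : ℂ → ℂ) : Prop where
  continuousOn : ContinuousOn Psi {w | 1 ≤ ‖w‖}
  conj : ∀ w : ℂ, 1 ≤ ‖w‖ → Psi (w ^ d) = P.eval (Psi w)
  tangent : Tendsto (fun w => Psi w / w) (Bornology.cobounded ℂ) (𝓝 1)

/-- The point of the unit circle with angle `θ`, measured in turns. -/
noncomputable def circlePt (θ : ℝ) : ℂ := Complex.exp (2 * Real.pi * θ * Complex.I)

/-- The `j`-th preimage branch in terms of angles: for `θ ∈ [0, 1)`, the preimage of `θ` under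
multiplication by `d` that lies in the arc `[j / d, (j + 1) / d)`. -/
noncomputable def branchAngle (d : ℕ) (j : Fin d) (θ : ℝ) : ℝ := (θ + (j : ℕ)) / d

/-- The preimage branch of order `n` of a word `η`, in terms of angles: the composition of
the branches of the letters, where the first letter acts first. -/
noncomputable def wordAngle (d : ℕ) : (n : ℕ) → (Fin n → Fin d) → ℝ → ℝ
  | 0, _, θ => θ
  | n + 1, η, θ => branchAngle d (η (Fin.last n)) (wordAngle d n (fun i => η i.castSucc) θ)

/-- The weighted preimage measure of order `n` of the point `ζ = Psi (circlePt θ)`: the sum over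
all the words `η` of length `n` of `p_{η_1} ⋯ p_{η_n}` times the unit mass at `P_η ζ`, where the
`j`-th branch `P_j` of the inverse of `P` sends the point with angle `θ ∈ [0, 1)` to the point with
angle `(θ + j) / d`. -/
noncomputable def weightedPreimageMeasure (d : ℕ) (p : Fin d → ℝ) (Psi : ℂ → ℂ) (θ : ℝ) (n : ℕ) :
    Measure ℂ :=
  ∑ η : Fin n → Fin d,
    ENNReal.ofReal (∏ i, p (η i)) • Measure.dirac (Psi (circlePt (wordAngle d n η θ)))

/-- `μ` is the weighted Lyubich measure of `P`: the weak limit of the weighted preimage measures of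
every point `ζ` of the loop, independently of `ζ`. -/
def IsWeightedLyubichMeasure (d : ℕ) (P : Polynomial ℂ) (p : Fin d → ℝ) (μ : Measure ℂ) : Prop :=
  IsProbabilityMeasure μ ∧ ∃ Psi : ℂ → ℂ, IsBoettcherParam d P Psi ∧
    ∀ θ ∈ Ico (0 : ℝ) 1, ∀ f : BoundedContinuousFunction ℂ ℝ,
      Tendsto (fun n => ∫ z, f z ∂(weightedPreimageMeasure d p Psi θ n)) atTop (𝓝 (∫ z, f z ∂μ))

open Classical in
/-- The weighted Lyubich measure (zero if there is none). -/
noncomputable def weightedLyubichMeasure (d : ℕ) (P : Polynomial ℂ) (p : Fin d → ℝ) : Measure ℂ :=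
  if h : ∃ μ, IsWeightedLyubichMeasure d P p μ then h.choose else 0

/-- The Lyapunov exponent of `P` with respect to `μ`, with the sign convention
`Λ_μ(P) = - ∫_{J_P} log |P'| dμ`. -/
noncomputable def lyapunovExponent (P : Polynomial ℂ) (μ : Measure ℂ) : ℝ :=
  -∫ z in juliaSet P, Real.log ‖P.derivative.eval z‖ ∂μ

/-- The Lyapunov exponent with respect to the weighted Lyubich measure of weight `p`, as a function
of the coefficient vector. -/
noncomputable def lyapunovFun (d : ℕ) (p : Fin d → ℝ) (A : Fin (d - 1) → ℂ) : ℝ :=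
  lyapunovExponent (centredPoly d A) (weightedLyubichMeasure d (centredPoly d A) p)

/-- The partial derivative with respect to the real part `α_r` of the `r`-th coefficient. -/
noncomputable def partialRe {m : ℕ} (r : Fin m) (F : (Fin m → ℂ) → ℝ) (A : Fin m → ℂ) : ℝ :=
  deriv (fun t : ℝ => F (A + Pi.single r (t : ℂ))) 0

/-- The partial derivative with respect to the imaginary part `β_r` of the `r`-th coefficient. -/
noncomputable def partialIm {m : ℕ} (r : Fin m) (F : (Fin m → ℂ) → ℝ) (A : Fin m → ℂ) : ℝ :=
  deriv (fun t : ℝ => F (A + Pi.single r ((t : ℂ) * Complex.I))) 0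

/-! Near each parameter the Lyapunov exponent is a constant minus the real part of a holomorphic
function of the coefficients (`exists_lyapunovFun_eventuallyEq_re`). Such a function is smooth and
pluriharmonic, and pluriharmonicity is the asserted identity: the two factors `I` in the imaginary
directions multiply to `-1`.

The weights act on angles alone. The branches contract angles by the factor `d`, so the weighted
averages over words converge to integration against a probability measure `ν` on angles that does
not depend on the polynomial (`exists_limit_wordAverage`). The weighted Lyubich measure is the image
of `ν` under `θ ↦ Psi (circlePt θ)`, so the coefficients enter only through `P'` and the Böttcher
parametrization.

The parametrization depends holomorphically on the coefficients
(`IsBoettcherParam.exists_contDiffAt_family`). The quotient `v = Psi / w` solves an equation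
polynomial in `v` and the coefficients, in the Banach algebra of bounded continuous functions on `1
≤ ‖w‖`. Its derivative in `v` is `v ↦ m v - v ∘ σ`, where `σ w = w ^ d` and `m = P'(Psi) / w ^ (d -
1)`. This is invertible because the products of `m` along orbits grow exponentially, and the
implicit function theorem applies. On the circle `P' ∘ Psi` is then a holomorphic family of
functions, invertible at the base point; the Banach algebra exponential gives it a holomorphic
logarithm near there, which is integrated against `ν`.

Two preliminaries remain. Openness (`eventually_mem_paramSpace`) comes from a compact set that an
iterate maps into its own interior, a property that survives perturbation. The parametrization is
found near infinity by a contraction, carried to `1 < ‖w‖` by lifting through the covering `P`, and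
extended to the circle by expansion near the Julia set (`exists_isBoettcherParam`). -/

/-! ### Iterates, their derivatives, and joint continuity in the coefficients and the point. -/

theorem centredPoly_eval (d : ℕ) (A : Fin (d - 1) → ℂ) (z : ℂ) :
    (centredPoly d A).eval z = z ^ d + ∑ r : Fin (d - 1), A r * z ^ (r : ℕ) := by
  simp [centredPoly, Polynomial.eval_finsetSum]

theorem centredPoly_derivative_eval (d : ℕ) (A : Fin (d - 1) → ℂ) (z : ℂ) :
    (centredPoly d A).derivative.eval z =
      d * z ^ (d - 1) + ∑ r : Fin (d - 1), A r * ((r : ℕ) * z ^ ((r : ℕ) - 1)) := by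
  simp [centredPoly, Polynomial.eval_finsetSum, Polynomial.derivative_X_pow]

theorem continuous_centredPoly_eval (d : ℕ) :
    Continuous fun q : (Fin (d - 1) → ℂ) × ℂ => (centredPoly d q.1).eval q.2 := by
  simp only [centredPoly_eval]; fun_prop

theorem continuous_centredPoly_derivative_eval (d : ℕ) :
    Continuous fun q : (Fin (d - 1) → ℂ) × ℂ => (centredPoly d q.1).derivative.eval q.2 := by
  simp only [centredPoly_derivative_eval]; fun_prop

theorem polyIter_succ (P : Polynomial ℂ) (n : ℕ) (z : ℂ) :
    polyIter P (n + 1) z = polyIter P n (P.eval z) := rfl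

theorem polyIter_succ' (P : Polynomial ℂ) (n : ℕ) (z : ℂ) :
    polyIter P (n + 1) z = P.eval (polyIter P n z) := by
  simp [polyIter, Function.iterate_succ_apply']

theorem polyIter_zero (P : Polynomial ℂ) (z : ℂ) : polyIter P 0 z = z := rfl

theorem polyIter_add (P : Polynomial ℂ) (m n : ℕ) (z : ℂ) :
    polyIter P (m + n) z = polyIter P m (polyIter P n z) := by
  simp [polyIter, Function.iterate_add_apply]

theorem continuous_polyIter_param (d n : ℕ) :
    Continuous fun q : (Fin (d - 1) → ℂ) × ℂ => polyIter (centredPoly d q.1) n q.2 := by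
  induction n with
  | zero => exact continuous_snd
  | succ n ih =>
    simp only [polyIter_succ']
    exact (continuous_centredPoly_eval d).comp (continuous_fst.prodMk ih)

theorem continuous_polyIter (P : Polynomial ℂ) (n : ℕ) : Continuous (polyIter P n) :=
  P.continuous.iterate n

theorem hasStrictDerivAt_polyIter (P : Polynomial ℂ) (n : ℕ) (z : ℂ) :
    HasStrictDerivAt (polyIter P n) (∏ k ∈ Finset.range n, P.derivative.eval (polyIter P k z)) z := by
  induction n with
  | zero => simpa using! hasStrictDerivAt_id z
  | succ n ih =>
    have h : polyIter P (n + 1) = (fun z => P.eval z) ∘ polyIter P n := by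
      ext z; exact polyIter_succ' P n z
    rw [h, Finset.prod_range_succ, mul_comm]
    exact (P.hasStrictDerivAt _).comp z ih

theorem deriv_polyIter (P : Polynomial ℂ) (n : ℕ) (z : ℂ) :
    deriv (polyIter P n) z = ∏ k ∈ Finset.range n, P.derivative.eval (polyIter P k z) :=
  (hasStrictDerivAt_polyIter P n z).hasDerivAt.deriv

theorem hasStrictDerivAt_polyIter' (P : Polynomial ℂ) (n : ℕ) (z : ℂ) :
    HasStrictDerivAt (polyIter P n) (deriv (polyIter P n) z) z := by
  rw [deriv_polyIter]
  exact hasStrictDerivAt_polyIter P n z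

theorem derivative_eval_ne_zero_of_deriv_polyIter_ne_zero (P : Polynomial ℂ) {n : ℕ} (hn : 0 < n)
    {z : ℂ} (h : deriv (polyIter P n) z ≠ 0) : P.derivative.eval z ≠ 0 := by
  rw [deriv_polyIter] at h
  exact Finset.prod_ne_zero_iff.1 h 0 (by simpa using hn)

theorem continuous_deriv_polyIter_param (d n : ℕ) :
    Continuous fun q : (Fin (d - 1) → ℂ) × ℂ => deriv (polyIter (centredPoly d q.1) n) q.2 := by
  simp only [deriv_polyIter]
  exact continuous_finsetProd _ fun k _ =>
    (continuous_centredPoly_derivative_eval d).comp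
      (continuous_fst.prodMk (continuous_polyIter_param d k))

/-! ### The escape radius 3 and the basin of infinity. -/

theorem sum_pow_le_half {m : ℕ} {x : ℝ} (hx : 3 ≤ x) :
    ∑ r : Fin m, x ^ (r : ℕ) ≤ x ^ m / 2 := by
  rw [Fin.sum_univ_eq_sum_range (fun r => x ^ r)]
  have h := geom_sum_mul x m
  have h0 : 0 ≤ ∑ i ∈ Finset.range m, x ^ i := Finset.sum_nonneg fun i _ => by positivity
  nlinarith

/-- The lower terms form at most a geometric sum, hence at most `‖z‖ ^ (d - 1) / 2`, which the
leading term dominates. The radius 3 is uniform over all coefficient vectors with entries of modulus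
at most one. -/
theorem two_mul_norm_le_eval {d : ℕ} (hd : 2 ≤ d) {A : Fin (d - 1) → ℂ} (hA : ∀ r, ‖A r‖ ≤ 1)
    {z : ℂ} (hz : 3 ≤ ‖z‖) : 2 * ‖z‖ ≤ ‖(centredPoly d A).eval z‖ := by
  rw [centredPoly_eval]
  have h1 : ‖∑ r : Fin (d - 1), A r * z ^ (r : ℕ)‖ ≤ ‖z‖ ^ (d - 1) / 2 := by
    refine (norm_sum_le _ _).trans ((Finset.sum_le_sum fun r _ => ?_).trans (sum_pow_le_half hz))
    rw [norm_mul, norm_pow]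
    exact mul_le_of_le_one_left (by positivity) (hA r)
  have h2 : ‖z ^ d‖ = ‖z‖ ^ (d - 1) * ‖z‖ := by
    rw [norm_pow, ← pow_succ]; congr 1; omega
  have h3 : ‖z‖ ≤ ‖z‖ ^ (d - 1) := le_self_pow₀ (by linarith) (by omega)
  have h4 := norm_sub_le (z ^ d + ∑ r : Fin (d - 1), A r * z ^ (r : ℕ))
    (∑ r : Fin (d - 1), A r * z ^ (r : ℕ))
  rw [add_sub_cancel_right] at h4
  nlinarith

theorem derivative_eval_ne_zero_of_large {d : ℕ} (hd : 2 ≤ d) {A : Fin (d - 1) → ℂ}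
    (hA : ∀ r, ‖A r‖ ≤ 1) {z : ℂ} (hz : 3 ≤ ‖z‖) : (centredPoly d A).derivative.eval z ≠ 0 := by
  rw [centredPoly_derivative_eval]
  intro h0
  have h1 : ‖∑ r : Fin (d - 1), A r * ((r : ℕ) * z ^ ((r : ℕ) - 1))‖ ≤
      d * (‖z‖ ^ (d - 1) / 2) := by
    refine (norm_sum_le _ _).trans (le_trans (Finset.sum_le_sum
      (g := fun r : Fin (d - 1) => (d : ℝ) * ‖z‖ ^ (r : ℕ)) fun r _ => ?_) ?_)
    · rw [norm_mul, norm_mul, norm_pow, Complex.norm_natCast]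
      have e1 : ((r : ℕ) : ℝ) ≤ d := by exact_mod_cast (by omega : (r : ℕ) ≤ d)
      have e2 : ‖z‖ ^ ((r : ℕ) - 1) ≤ ‖z‖ ^ (r : ℕ) :=
        pow_le_pow_right₀ (by linarith) (by omega)
      calc _ ≤ 1 * ((d : ℝ) * ‖z‖ ^ (r : ℕ)) := by gcongr; exact hA r
        _ = _ := one_mul _
    · rw [← Finset.mul_sum]
      gcongr
      exact sum_pow_le_half hz
  have h2 := eq_neg_of_add_eq_zero_right h0
  rw [h2, norm_neg, norm_mul, norm_pow, Complex.norm_natCast] at h1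
  have h3 : 0 < (d : ℝ) * ‖z‖ ^ (d - 1) := by
    have : (0 : ℝ) < d := by exact_mod_cast (by omega : 0 < d)
    have : 0 < ‖z‖ := by linarith
    positivity
  linarith

section Escape

variable {d : ℕ} (hd : 2 ≤ d) {A : Fin (d - 1) → ℂ} (hA : ∀ r, ‖A r‖ ≤ 1)
include hd hA

theorem pow_two_mul_norm_le_polyIter {z : ℂ} (hz : 3 ≤ ‖z‖) (n : ℕ) :
    2 ^ n * ‖z‖ ≤ ‖polyIter (centredPoly d A) n z‖ := by
  induction n with
  | zero => simp [polyIter_zero]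
  | succ n ih =>
    rw [polyIter_succ']
    have : 3 ≤ ‖polyIter (centredPoly d A) n z‖ := by
      have : (1 : ℝ) ≤ 2 ^ n := one_le_pow₀ (by norm_num)
      nlinarith
    have := two_mul_norm_le_eval hd hA this
    rw [pow_succ]; linarith

theorem norm_le_polyIter {z : ℂ} (hz : 3 ≤ ‖z‖) (n : ℕ) :
    ‖z‖ ≤ ‖polyIter (centredPoly d A) n z‖ := by
  have h := pow_two_mul_norm_le_polyIter hd hA hz n
  have : (1 : ℝ) ≤ 2 ^ n := one_le_pow₀ (by norm_num)
  nlinarith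

theorem tendsto_polyIter_of_large {z : ℂ} (hz : 3 ≤ ‖z‖) :
    Tendsto (fun n => ‖polyIter (centredPoly d A) n z‖) atTop atTop := by
  refine tendsto_atTop_mono (pow_two_mul_norm_le_polyIter hd hA hz) ?_
  exact (tendsto_pow_atTop_atTop_of_one_lt (by norm_num)).atTop_mul_const (by linarith)

/-- Once an orbit leaves the disk of radius 3 its modulus at least doubles at each step. Escape thus
becomes a condition on a single iterate, which is open in the point and the coefficients together.
-/
theorem mem_basinInfinity_iff {z : ℂ} :
    z ∈ basinInfinity (centredPoly d A) ↔ ∃ n, 3 < ‖polyIter (centredPoly d A) n z‖ := by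
  simp only [basinInfinity, mem_ofPred_eq, ← tendsto_norm_atTop_iff_cobounded]
  constructor
  · intro h
    exact (h.eventually_gt_atTop 3).exists
  · rintro ⟨n, hn⟩
    refine (tendsto_add_atTop_iff_nat n).1 ?_
    simp only [polyIter_add]
    exact tendsto_polyIter_of_large hd hA hn.le

theorem isOpen_basinInfinity : IsOpen (basinInfinity (centredPoly d A)) := by
  have : basinInfinity (centredPoly d A) =
      ⋃ n, {z | 3 < ‖polyIter (centredPoly d A) n z‖} := by
    ext z; simp [mem_basinInfinity_iff hd hA]
  rw [this]
  exact isOpen_iUnion fun n => isOpen_lt continuous_const (continuous_polyIter _ n).norm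

theorem isClosed_filledJulia : IsClosed (filledJulia (centredPoly d A)) :=
  (isOpen_basinInfinity hd hA).isClosed_compl

theorem norm_le_three_of_mem_filledJulia {z : ℂ} (hz : z ∈ filledJulia (centredPoly d A)) :
    ‖z‖ ≤ 3 := by
  by_contra! h
  exact hz ((mem_basinInfinity_iff hd hA).2 ⟨0, h⟩)

omit hd hA in
theorem mem_filledJulia_of_isBounded {z : ℂ} {M : ℝ} {N : ℕ} (hN : 0 < N)
    (h : ∀ n, ‖polyIter (centredPoly d A) (N * n) z‖ ≤ M) :
    z ∈ filledJulia (centredPoly d A) := by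
  intro hz
  have h1 : Tendsto (fun n => ‖polyIter (centredPoly d A) n z‖) atTop atTop :=
    tendsto_norm_atTop_iff_cobounded.2 hz
  have h2 := h1.comp (tendsto_id.const_mul_atTop' hN)
  obtain ⟨n, hn⟩ := (h2.eventually_gt_atTop M).exists
  exact absurd (h n) (not_le.2 hn)

theorem isCompact_filledJulia : IsCompact (filledJulia (centredPoly d A)) :=
  (isCompact_closedBall (0 : ℂ) 3).of_isClosed_subset (isClosed_filledJulia hd hA)
    fun z hz => by simpa using norm_le_three_of_mem_filledJulia hd hA hz

theorem juliaSet_subset_filledJulia :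
    juliaSet (centredPoly d A) ⊆ filledJulia (centredPoly d A) :=
  (isClosed_filledJulia hd hA).frontier_subset

theorem isCompact_juliaSet : IsCompact (juliaSet (centredPoly d A)) :=
  (isCompact_filledJulia hd hA).of_isClosed_subset isClosed_frontier
    (juliaSet_subset_filledJulia hd hA)

omit hd hA in
theorem eval_mem_basinInfinity_iff (P : Polynomial ℂ) {z : ℂ} :
    P.eval z ∈ basinInfinity P ↔ z ∈ basinInfinity P := by
  simp only [basinInfinity, mem_ofPred_eq, ← polyIter_succ]
  exact tendsto_add_atTop_iff_nat (f := fun n => polyIter P n z) 1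

omit hd hA in
theorem polyIter_mem_basinInfinity_iff (P : Polynomial ℂ) (n : ℕ) {z : ℂ} :
    polyIter P n z ∈ basinInfinity P ↔ z ∈ basinInfinity P := by
  induction n with
  | zero => rfl
  | succ n ih => rw [polyIter_succ', eval_mem_basinInfinity_iff, ih]

omit hA in
theorem centredPoly_monic : (centredPoly d A).Monic ∧ (centredPoly d A).natDegree = d := by
  have h : (∑ r : Fin (d - 1), Polynomial.C (A r) * Polynomial.X ^ (r : ℕ)).degree <
      (d : WithBot ℕ) := by
    refine (Polynomial.degree_sum_le _ _).trans_lt ?_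
    rw [Finset.sup_lt_iff (by exact WithBot.bot_lt_coe d)]
    intro r _
    refine (Polynomial.degree_C_mul_X_pow_le _ _).trans_lt ?_
    exact_mod_cast (by omega : (r : ℕ) < d)
  refine ⟨Polynomial.monic_X_pow_add h, ?_⟩
  rw [centredPoly, add_comm, Polynomial.natDegree_add_eq_right_of_degree_lt] 
  · simp
  · simpa using h

end Escape

/-! ### Complete invariance of the Julia set and location of the critical points. -/

theorem isOpenMap_polynomial_eval (P : Polynomial ℂ) (hP : 0 < P.natDegree) :
    IsOpenMap fun z => P.eval z := by
  have h : AnalyticOnNhd ℂ (fun z => P.eval z) univ := fun z _ => by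
    simpa using! AnalyticAt.aeval_polynomial (analyticAt_id (𝕜 := ℂ) (z := z)) P
  rcases h.is_constant_or_isOpen isPreconnected_univ with ⟨w, hw⟩ | h
  · exfalso
    have : P = Polynomial.C w := Polynomial.funext fun z => by simpa using hw z (mem_univ z)
    simp [this] at hP
  · intro s hs
    exact h s (subset_univ s) hs

section JuliaInvariance

variable {d : ℕ} (hd : 2 ≤ d) {A : Fin (d - 1) → ℂ}
include hd

/-- The filled Julia set is its own preimage, and taking preimages under an open continuous map
commutes with taking frontiers. -/
theorem eval_mem_juliaSet_iff {z : ℂ} :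
    (centredPoly d A).eval z ∈ juliaSet (centredPoly d A) ↔ z ∈ juliaSet (centredPoly d A) := by
  have h := (isOpenMap_polynomial_eval (centredPoly d A)
    (by rw [(centredPoly_monic hd).2]; omega)).preimage_frontier_eq_frontier_preimage
    (centredPoly d A).continuous (filledJulia (centredPoly d A))
  have h2 : (fun z => (centredPoly d A).eval z) ⁻¹' filledJulia (centredPoly d A) =
      filledJulia (centredPoly d A) := by
    ext z; exact not_congr (eval_mem_basinInfinity_iff _)
  rw [h2] at h
  exact Set.ext_iff.1 h z

theorem polyIter_mem_juliaSet_iff (n : ℕ) {z : ℂ} :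
    polyIter (centredPoly d A) n z ∈ juliaSet (centredPoly d A) ↔
      z ∈ juliaSet (centredPoly d A) := by
  induction n with
  | zero => rfl
  | succ n ih => rw [polyIter_succ', eval_mem_juliaSet_iff hd, ih]

omit hd in
theorem derivative_eval_ne_zero_of_mem_juliaSet (hyp : IsHyperbolicPoly (centredPoly d A)) {z : ℂ}
    (hz : z ∈ juliaSet (centredPoly d A)) : (centredPoly d A).derivative.eval z ≠ 0 := by
  obtain ⟨C, hC, lam, hlam, h⟩ := hyp
  intro h0
  have := h z hz 1 le_rfl
  rw [deriv_polyIter] at this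
  simp [polyIter_zero, h0] at this
  have : 0 < C * lam := by positivity
  linarith

omit hd in
theorem mem_filledJulia_of_critical (hb : HasBoundedCriticalOrbits (centredPoly d A)) {c : ℂ}
    (hc : (centredPoly d A).derivative.eval c = 0) : c ∈ filledJulia (centredPoly d A) := by
  obtain ⟨M, hM⟩ := (hb c hc).exists_norm_le
  exact mem_filledJulia_of_isBounded (M := M) (N := 1) one_pos
    fun n => hM _ ⟨1 * n, rfl⟩

omit hd in
theorem derivative_eval_ne_zero_of_mem_basinInfinity
    (hb : HasBoundedCriticalOrbits (centredPoly d A)) {z : ℂ}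
    (hz : z ∈ basinInfinity (centredPoly d A)) : (centredPoly d A).derivative.eval z ≠ 0 :=
  fun h => mem_filledJulia_of_critical hb h hz

end JuliaInvariance

theorem norm_lt_one_of_mem_paramSpace {d : ℕ} {A : Fin (d - 1) → ℂ} (hA : A ∈ paramSpace d)
    (r : Fin (d - 1)) : ‖A r‖ < 1 := by
  have h := hA.1 r
  have h2 : ‖A r‖ ^ 2 = (A r).re ^ 2 + (A r).im ^ 2 := by
    rw [← Complex.normSq_eq_norm_sq, Complex.normSq_apply]; ring
  nlinarith [norm_nonneg (A r)]

/-! ### Openness of the parameter space. -/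

/-- Cut the orbit into blocks of length at most `N`, each contributing a factor at least `3 / 2`.
The unfinished last block costs only a constant, by the lower bound `c`. -/
theorem exists_uniform_growth {X : Type*} (σ : X → X) (m : X → ℝ) {c : ℝ} (hc : 0 < c)
    (hm : ∀ x, c ≤ m x) (N : ℕ)
    (h : ∀ x, ∃ n, 1 ≤ n ∧ n ≤ N ∧ 3 / 2 ≤ ∏ k ∈ Finset.range n, m (σ^[k] x)) :
    ∃ C : ℝ, 0 < C ∧ ∃ κ : ℝ, 1 < κ ∧
      ∀ x n, C * κ ^ n ≤ ∏ k ∈ Finset.range n, m (σ^[k] x) := by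
  rcases isEmpty_or_nonempty X with hX | ⟨⟨x0⟩⟩
  · exact ⟨1, one_pos, 2, one_lt_two, fun x => hX.elim x⟩
  have hN : N ≠ 0 := by
    obtain ⟨n, h1, h2, -⟩ := h x0
    omega
  set κ : ℝ := (3 / 2 : ℝ) ^ ((N : ℝ)⁻¹) with hκ
  have hκN : κ ^ N = 3 / 2 := Real.rpow_inv_natCast_pow (by norm_num) hN
  have hκ1 : 1 < κ := Real.one_lt_rpow (by norm_num) (by positivity)
  -- A bound at most one makes `c' ^ N` a lower bound for every shorter product.
  set c' := min c 1
  have hc' : 0 < c' := lt_min hc one_pos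
  have hc'1 : c' ≤ 1 := min_le_right _ _
  have hmc (x) : c' ≤ m x := (min_le_left _ _).trans (hm x)
  refine ⟨c' ^ N / κ ^ N, by positivity, κ, hκ1, fun x n => ?_⟩
  induction n using Nat.strong_induction_on generalizing x with
  | _ n ih =>
    rcases lt_or_ge n N with hn | hn
    · calc c' ^ N / κ ^ N * κ ^ n ≤ c' ^ N / κ ^ N * κ ^ N := by
            gcongr
            exact hκ1.le
        _ = c' ^ N := by field_simp
        _ ≤ c' ^ n := pow_le_pow_of_le_one hc'.le hc'1 hn.le
        _ = ∏ k ∈ Finset.range n, c' := by simp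
        _ ≤ _ := Finset.prod_le_prod (fun _ _ => hc'.le) fun k _ => hmc _
    · obtain ⟨n₁, h1, h2, h3⟩ := h x
      obtain ⟨l, rfl⟩ := Nat.exists_eq_add_of_le (h2.trans hn)
      rw [Finset.prod_range_add]
      have h4 := ih l (by omega) (σ^[n₁] x)
      simp only [← Function.iterate_add_apply, add_comm _ n₁] at h4
      calc c' ^ N / κ ^ N * κ ^ (n₁ + l) = κ ^ n₁ * (c' ^ N / κ ^ N * κ ^ l) := by ring
        _ ≤ κ ^ N * (c' ^ N / κ ^ N * κ ^ l) := by
            gcongr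
            exact hκ1.le
        _ ≤ _ := by
            rw [hκN] at h4 ⊢
            exact mul_le_mul h3 h4 (by positivity) (by linarith)

/-- Strict differentiability compares two nearby points with each other and not only with the
centre, at the loss of `1 / 2` from the factor 2. A Lebesgue number of the resulting cover makes the
radius uniform. -/
theorem IsCompact.exists_expanding_radius {J : Set ℂ} (hJ : IsCompact J) {Q : ℂ → ℂ}
    (hQ : ∀ y ∈ J, ∃ q, HasStrictDerivAt Q q y ∧ 2 ≤ ‖q‖) :
    ∃ η > 0, ∀ y ∈ J, ∀ z z' : ℂ, dist z y < η → dist z' y < η →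
      3 / 2 * dist z z' ≤ dist (Q z) (Q z') := by
  have key : ∀ y : J, ∃ ε > 0, ∀ z z' : ℂ, dist z (y : ℂ) < ε → dist z' y < ε →
      3 / 2 * dist z z' ≤ dist (Q z) (Q z') := by
    rintro ⟨y, hy⟩
    obtain ⟨q, hq, hq2⟩ := hQ y hy
    have := (hasStrictDerivAt_iff_hasStrictFDerivAt.1 hq).isLittleO.def (c := 1 / 2) (by norm_num)
    obtain ⟨ε, hε, h⟩ := Metric.eventually_nhds_iff.1 this
    refine ⟨ε, hε, fun z z' hz hz' => ?_⟩
    have h1 := @h (z, z') (by simp [Prod.dist_eq]; exact ⟨hz, hz'⟩)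
    have h2 : ‖(z - z') * q‖ = dist z z' * ‖q‖ := by rw [norm_mul, dist_eq_norm]
    have h1' : ‖Q z - Q z' - (z - z') * q‖ ≤ 1 / 2 * dist z z' := by
      simpa [dist_eq_norm] using h1
    rw [dist_eq_norm (Q z)]
    have h3 := norm_sub_norm_le ((z - z') * q) (Q z - Q z')
    rw [norm_sub_rev] at h1'
    have : 0 ≤ dist z z' := dist_nonneg
    nlinarith
  choose ε hε h using key
  obtain ⟨δ, hδ, hsub⟩ := lebesgue_number_lemma_of_metric hJ (c := fun y : J => Metric.ball (y : ℂ) (ε y))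
    (fun _ => Metric.isOpen_ball) fun y hy => mem_iUnion.2 ⟨⟨y, hy⟩, Metric.mem_ball_self (hε _)⟩
  refine ⟨δ, hδ, fun y hy z z' hz hz' => ?_⟩
  obtain ⟨i, hi⟩ := hsub y hy
  exact h i z z' (hi hz) (hi hz')

/-- The monic polynomial `P - y'` splits, so if all its roots were at distance at least `δ` from
`z`, its value at `z` would have modulus at least `δ ^ P.natDegree`. No assumption on critical
points is needed. -/
theorem exists_near_preimage (P : Polynomial ℂ) (hP : P.Monic) (hd : 0 < P.natDegree) (n : ℕ)
    {δ : ℝ} (hδ : 0 < δ) : ∃ ε > 0, ∀ z x, dist (polyIter P n z) x < ε →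
      ∃ y, polyIter P n y = x ∧ dist z y < δ := by
  induction n generalizing δ with
  | zero => exact ⟨δ, hδ, fun z x h => ⟨x, rfl, h⟩⟩
  | succ n ih =>
    obtain ⟨ε, hε, h⟩ := ih (pow_pos hδ P.natDegree)
    refine ⟨ε, hε, fun z x hz => ?_⟩
    obtain ⟨y', hy', hdist⟩ := h _ _ hz
    have hlt : (Polynomial.C y').degree < P.degree :=
      Polynomial.degree_C_le.trans_lt (Polynomial.natDegree_pos_iff_degree_pos.1 hd)
    have hm : (P - Polynomial.C y').Monic := hP.sub_of_left hlt
    have hnd : (P - Polynomial.C y').natDegree = P.natDegree := by simp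
    have hs := IsAlgClosed.splits (P - Polynomial.C y')
    have hprod := hs.eval_eq_prod_roots_of_monic hm z
    have hcard := hs.natDegree_eq_card_roots
    by_contra! hcon
    have hroots : ∀ y ∈ (P - Polynomial.C y').roots, δ ≤ ‖z - y‖ := by
      intro y hy
      rw [Polynomial.mem_roots hm.ne_zero, Polynomial.IsRoot.def] at hy
      have : polyIter P (n + 1) y = x := by
        rw [polyIter_succ, ← hy']
        congr 1
        simpa [sub_eq_zero] using hy
      rw [← dist_eq_norm]
      exact hcon y this
    have hle : δ ^ P.natDegree ≤ ‖(P - Polynomial.C y').eval z‖ := by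
      rw [hprod, ← hnd, hcard]
      generalize (P - Polynomial.C y').roots = s at hroots
      clear * - hroots hδ
      induction s using Multiset.induction_on with
      | empty => simp
      | cons a s ih =>
        simp only [Multiset.map_cons, Multiset.prod_cons, norm_mul, Multiset.card_cons, pow_succ']
        exact mul_le_mul (hroots a (by simp)) (ih fun y hy => hroots y (by simp [hy]))
          (by positivity) (norm_nonneg _)
    rw [Polynomial.eval_sub, Polynomial.eval_C, ← dist_eq_norm] at hle
    exact absurd hdist (not_lt.2 hle)

/-- The ball is connected and misses the frontier, so it cannot meet both the interior and the
complement of `K`. -/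
theorem ball_subset_of_disjoint_frontier {K : Set ℂ} (hK : IsClosed K) {z : ℂ} (hz : z ∈ K) {r : ℝ}
    (hr : z ∉ Metric.thickening r (frontier K)) : Metric.ball z r ⊆ K := by
  intro v hv
  have hr0 : 0 < r := dist_nonneg.trans_lt hv
  have hf : ∀ w ∈ Metric.ball z r, w ∉ frontier K := fun w hw hwf =>
    hr (Metric.mem_thickening_iff.2 ⟨w, hwf, by rw [dist_comm]; exact hw⟩)
  have hcov : Metric.ball z r ⊆ interior K ∪ Kᶜ := by
    intro w hw
    by_cases hwK : w ∈ K
    · left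
      by_contra h
      exact hf w hw (by rw [hK.frontier_eq]; exact ⟨hwK, h⟩)
    · exact Or.inr hwK
  have hzi : z ∈ interior K := by
    rcases hcov (Metric.mem_ball_self hr0) with h | h
    · exact h
    · exact absurd hz h
  have := (convex_ball z r).isPreconnected.subset_left_of_subset_union isOpen_interior
    hK.isOpen_compl (disjoint_compl_right.mono_left interior_subset) hcov
    ⟨z, Metric.mem_ball_self hr0, hzi⟩
  exact interior_subset (this hv)

theorem mem_interior_diff_thickening {K : Set ℂ} (hK : IsClosed K) {z : ℂ} (hz : z ∈ K) {ε r : ℝ}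
    (hε : 0 ≤ ε) (hεr : ε < r) (hr : z ∉ Metric.thickening r (frontier K)) :
    z ∈ interior (K \ Metric.thickening ε (frontier K)) := by
  rw [mem_interior]
  refine ⟨Metric.ball z (r - ε), fun v hv => ⟨?_, fun hvt => ?_⟩, Metric.isOpen_ball,
    Metric.mem_ball_self (by linarith)⟩
  · exact ball_subset_of_disjoint_frontier hK hz hr (Metric.ball_subset_ball (by linarith) hv)
  · obtain ⟨y, hy, hd⟩ := Metric.mem_thickening_iff.1 hvt
    refine hr (Metric.mem_thickening_iff.2 ⟨y, hy, ?_⟩)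
    have := dist_triangle z v y
    rw [Metric.mem_ball, dist_comm] at hv
    linarith

theorem isHyperbolicPoly_of_iterate {d : ℕ} (hd : 2 ≤ d) {A : Fin (d - 1) → ℂ}
    (hA : ∀ r, ‖A r‖ ≤ 1) {N : ℕ} (hN : 0 < N)
    (h : ∀ z ∈ juliaSet (centredPoly d A), 3 / 2 ≤ ‖deriv (polyIter (centredPoly d A) N) z‖) :
    IsHyperbolicPoly (centredPoly d A) := by
  set P := centredPoly d A
  have hne : ∀ z ∈ juliaSet P, 0 < ‖P.derivative.eval z‖ := fun z hz => by
    have := h z hz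
    refine norm_pos_iff.2 (derivative_eval_ne_zero_of_deriv_polyIter_ne_zero P hN fun h0 => ?_)
    rw [h0, norm_zero] at this
    norm_num at this
  obtain ⟨c, hc, hcJ⟩ := (isCompact_juliaSet hd hA).exists_forall_le'
    P.derivative.continuous.norm.continuousOn hne
  let σ : juliaSet P → juliaSet P := fun z => ⟨P.eval z, (eval_mem_juliaSet_iff hd).2 z.2⟩
  have hσ : ∀ k (z : juliaSet P), ((σ^[k] z : juliaSet P) : ℂ) = polyIter P k z := by
    intro k
    induction k with
    | zero => exact fun z => rfl
    | succ k ih =>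
      intro z
      rw [Function.iterate_succ_apply', polyIter_succ', ← ih]
  obtain ⟨C, hC, κ, hκ, hg⟩ := exists_uniform_growth σ (fun z => ‖P.derivative.eval (z : ℂ)‖) hc
    (fun z => hcJ z z.2) N fun z => ⟨N, hN, le_rfl, by
      simpa only [deriv_polyIter, norm_prod, hσ] using h z z.2⟩
  refine ⟨C, hC, κ, hκ, fun z hz n _ => ?_⟩
  simpa only [deriv_polyIter, norm_prod, hσ] using hg ⟨z, hz⟩ n

/-- The filled Julia set minus a thin neighbourhood of the Julia set is a compact trapping region
`L` for `P ^ N`. For nearby coefficients `L` is still trapped, hence inside the new filled Julia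
set. It still contains all critical points, and the new Julia set stays near the old one, where the
iterate still expands. -/
theorem eventually_mem_paramSpace {d : ℕ} (hd : 2 ≤ d) {A : Fin (d - 1) → ℂ}
    (hA : A ∈ paramSpace d) : ∀ᶠ B in 𝓝 A, B ∈ paramSpace d := by
  have hA1 : ∀ r, ‖A r‖ ≤ 1 := fun r => (norm_lt_one_of_mem_paramSpace hA r).le
  obtain ⟨C, hC, lam, hlam, hyp⟩ := hA.2.1
  obtain ⟨N, hN2, hN⟩ := ((((tendsto_pow_atTop_atTop_of_one_lt hlam).const_mul_atTop
    hC).eventually_ge_atTop 2).and (eventually_ge_atTop 1)).exists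
  set P := centredPoly d A with hP
  set J := juliaSet P with hJ
  set K := filledJulia P with hK
  have hJc : IsCompact J := isCompact_juliaSet hd hA1
  have hKc : IsCompact K := isCompact_filledJulia hd hA1
  have hder : ∀ y ∈ J, 2 ≤ ‖deriv (polyIter P N) y‖ := fun y hy => hN2.trans (hyp y hy N hN)
  obtain ⟨η, hη, hexp⟩ := hJc.exists_expanding_radius (Q := polyIter P N) fun y hy =>
    ⟨_, hasStrictDerivAt_polyIter' P N y, hder y hy⟩
  obtain ⟨ε₀, hε₀, hpre⟩ := exists_near_preimage P (centredPoly_monic hd).1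
    (by rw [(centredPoly_monic hd).2]; omega) N hη
  have hcont : Continuous fun z => ‖deriv (polyIter P N) z‖ :=
    ((continuous_deriv_polyIter_param d N).comp (Continuous.prodMk_right A)).norm
  obtain ⟨δ, hδ, hδJ⟩ := hJc.exists_cthickening_subset_open
    (isOpen_lt (continuous_const (y := (3 / 2 : ℝ))) hcont) fun y hy => by
      have := hder y hy
      simp only [mem_ofPred_eq]
      linarith
  obtain ⟨ε, hε, hεδ, hεε⟩ : ∃ ε > 0, ε < δ ∧ 3 / 2 * ε ≤ ε₀ :=
    -- `ε < δ` keeps the critical points off the neighbourhood removed; `3 / 2 * ε ≤ ε₀` lets `hpre`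
    -- supply a preimage close enough for the expansion estimate.
    ⟨min (ε₀ / 2) (δ / 2), by positivity,
      (min_le_right _ _).trans_lt (by linarith), by linarith [min_le_left (ε₀ / 2) (δ / 2)]⟩
  -- Expansion read backwards: an image within `3 / 2 * ε` of `J` forces the point to lie within `ε`
  -- of `J`. The gain from `ε` to `3 / 2 * ε` puts the image of `L` in the interior.
  have hout : ∀ z, z ∉ Metric.thickening ε J → polyIter P N z ∉ Metric.thickening (3 / 2 * ε) J := by
    intro z hz hQ
    obtain ⟨x, hx, hdx⟩ := Metric.mem_thickening_iff.1 hQ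
    obtain ⟨y, rfl, hy⟩ := hpre z x (hdx.trans_le hεε)
    have hyJ : y ∈ J := (polyIter_mem_juliaSet_iff hd N).1 hx
    have := hexp y hyJ z y hy (by simpa using hη)
    exact hz (Metric.mem_thickening_iff.2 ⟨y, hyJ, by linarith⟩)
  set L := K \ Metric.thickening ε J with hL
  have hLc : IsCompact L := hKc.diff Metric.isOpen_thickening
  have hLL : ∀ z ∈ L, polyIter P N z ∈ interior L := fun z hz =>
    mem_interior_diff_thickening hKc.isClosed
      (fun h => hz.1 ((polyIter_mem_basinInfinity_iff P N).1 h)) hε.le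
      (by linarith : ε < 3 / 2 * ε) (hout z hz.2)
  have e1 : ∀ᶠ B in 𝓝 A, ∀ z ∈ L, polyIter (centredPoly d B) N z ∈ interior L :=
    hLc.eventually_forall_of_forall_eventually fun z hz =>
      (continuous_polyIter_param d N).continuousAt.eventually_mem
        (isOpen_interior.mem_nhds (hLL z hz))
  have e2 : ∀ᶠ B in 𝓝 A, ∀ z ∈ Metric.closedBall (0 : ℂ) 3 \ interior L,
      (centredPoly d B).derivative.eval z ≠ 0 :=
    ((isCompact_closedBall 0 3).diff isOpen_interior).eventually_forall_of_forall_eventually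
      fun z hz => (continuous_centredPoly_derivative_eval d).continuousAt.eventually_ne fun h0 => by
        refine hz.2 (mem_interior_diff_thickening hKc.isClosed
          (mem_filledJulia_of_critical hA.2.2 h0) hε.le hεδ fun hth => ?_)
        have := hδJ (Metric.thickening_subset_cthickening _ _ hth)
        simp only [mem_ofPred_eq] at this
        exact derivative_eval_ne_zero_of_deriv_polyIter_ne_zero P hN
          (norm_pos_iff.1 (by linarith)) h0
  have e3 : ∀ᶠ B in 𝓝 A, ∀ z ∈ Metric.closedBall (0 : ℂ) 3 \ (interior K ∪ Metric.thickening ε J),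
      ∃ n, 3 < ‖polyIter (centredPoly d B) n z‖ := by
    refine ((isCompact_closedBall 0 3).diff
      (isOpen_interior.union Metric.isOpen_thickening)).eventually_forall_of_forall_eventually
      fun z hz => ?_
    have hzb : z ∈ basinInfinity P := by
      by_contra hzK
      refine hz.2 (or_iff_not_imp_left.2 fun hi => ?_)
      exact Metric.self_subset_thickening hε _ (by
        rw [hJ, juliaSet, hKc.isClosed.frontier_eq]; exact ⟨hzK, hi⟩)
    obtain ⟨n, hn⟩ := (mem_basinInfinity_iff hd hA1).1 hzb
    filter_upwards [(continuous_polyIter_param d n).norm.continuousAt.eventually_const_lt hn]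
      with q hq using ⟨n, hq⟩
  have e4 : ∀ᶠ B in 𝓝 A, ∀ z ∈ Metric.cthickening δ J,
      3 / 2 < ‖deriv (polyIter (centredPoly d B) N) z‖ :=
    hJc.cthickening.eventually_forall_of_forall_eventually fun z hz =>
      (continuous_deriv_polyIter_param d N).norm.continuousAt.eventually_const_lt (hδJ hz)
  have e5 : ∀ᶠ B in 𝓝 A, ∀ r, ‖B r‖ < 1 := by
    rw [eventually_all]
    exact fun r => (continuous_apply r).norm.continuousAt.eventually_lt_const
      (norm_lt_one_of_mem_paramSpace hA r)
  filter_upwards [e1, e2, e3, e4, e5] with B h1 h2 h3 h4 h5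
  have hB1 : ∀ r, ‖B r‖ ≤ 1 := fun r => (h5 r).le
  obtain ⟨M, hM⟩ := hLc.isBounded.exists_norm_le
  have hLK : L ⊆ filledJulia (centredPoly d B) := by
    intro z hz
    refine mem_filledJulia_of_isBounded (M := M) hN fun n => hM _ ?_
    induction n with
    | zero => exact hz
    | succ n ih =>
      rw [mul_add, mul_one, add_comm, polyIter_add]
      exact interior_subset (h1 _ ih)
  refine ⟨fun r => ?_, ?_, ?_⟩
  · have h := h5 r
    have h2 : ‖B r‖ ^ 2 = (B r).re ^ 2 + (B r).im ^ 2 := by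
      rw [← Complex.normSq_eq_norm_sq, Complex.normSq_apply]; ring
    nlinarith [norm_nonneg (B r)]
  · refine isHyperbolicPoly_of_iterate hd hB1 hN fun z hz => (h4 z ?_).le
    have hzK := juliaSet_subset_filledJulia hd hB1 hz
    have hz3 : z ∈ Metric.closedBall (0 : ℂ) 3 := by
      simpa using norm_le_three_of_mem_filledJulia hd hB1 hzK
    refine Metric.thickening_subset_cthickening _ _ (Metric.thickening_mono hεδ.le _ ?_)
    by_contra hth
    by_cases hi : z ∈ interior K
    -- A Julia point of the perturbed map lying in `L` would be sent into the interior of the new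
    -- filled Julia set, against invariance of the Julia set.
    · have hQ := (polyIter_mem_juliaSet_iff hd N).2 hz
      exact hQ.2 (interior_mono hLK (h1 z ⟨interior_subset hi, hth⟩))
    · exact hzK ((mem_basinInfinity_iff hd hB1).2 (h3 z ⟨hz3, fun h => h.elim hi hth⟩))
  · intro c hc
    have hc3 : ‖c‖ < 3 := by
      by_contra! h
      exact derivative_eval_ne_zero_of_large hd hB1 h hc
    have hcL : c ∈ L := by
      by_contra h
      exact h2 c ⟨by simpa using hc3.le, fun hi => h (interior_subset hi)⟩ hc
    refine isBounded_iff_forall_norm_le.2 ⟨3, ?_⟩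
    rintro _ ⟨n, rfl⟩
    exact norm_le_three_of_mem_filledJulia hd hB1
      fun h => hLK hcL ((polyIter_mem_basinInfinity_iff _ n).1 h)

/-! ### The Böttcher parametrization near infinity: contraction, uniqueness and tangency. -/

/-- A Böttcher parametrization of `P` on the complement of the disk of radius `R`. -/
structure IsBoettcherOn (d : ℕ) (P : Polynomial ℂ) (R : ℝ) (Psi : ℂ → ℂ) : Prop where
  continuousOn : ContinuousOn Psi {w | R ≤ ‖w‖}
  conj : ∀ w : ℂ, R ≤ ‖w‖ → Psi (w ^ d) = P.eval (Psi w)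
  tangent : Tendsto (fun w => Psi w / w) (Bornology.cobounded ℂ) (𝓝 1)

theorem isBoettcherOn_one_iff {d : ℕ} {P : Polynomial ℂ} {Psi : ℂ → ℂ} :
    IsBoettcherOn d P 1 Psi ↔ IsBoettcherParam d P Psi :=
  ⟨fun h => ⟨h.1, h.2, h.3⟩, fun h => ⟨h.1, h.2, h.3⟩⟩

theorem IsBoettcherOn.mono {d : ℕ} {P : Polynomial ℂ} {R R' : ℝ} {Psi : ℂ → ℂ}
    (h : IsBoettcherOn d P R Psi) (hR : R ≤ R') : IsBoettcherOn d P R' Psi :=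
  ⟨h.1.mono fun _ hw => hR.trans hw, fun w hw => h.2 w (hR.trans hw), h.3⟩

/-- The nonlinear part of the functional equation of the Böttcher parametrization, written as
`w * (1 + x)`. -/
noncomputable def boettcherRemainder (d : ℕ) (x : ℂ) (c : Fin (d - 1) → ℂ) : ℂ :=
  (1 + x) ^ d - 1 - d * x + ∑ r, c r * (1 + x) ^ (r : ℕ)

/-- The coefficients of `P (w z) / w ^ d` as a polynomial in `z`. -/
noncomputable def scaledCoeff (d : ℕ) (A : Fin (d - 1) → ℂ) (w : ℂ) : Fin (d - 1) → ℂ :=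
  fun r => A r * (w⁻¹) ^ (d - (r : ℕ))

theorem centredPoly_eval_mul (d : ℕ) (A : Fin (d - 1) → ℂ) {w : ℂ} (hw : w ≠ 0) (x : ℂ) :
    (centredPoly d A).eval (w * (1 + x)) =
      w ^ d * (1 + (d * x + boettcherRemainder d x (scaledCoeff d A w))) := by
  have h : ∀ r : Fin (d - 1), w ^ d * (w⁻¹) ^ (d - (r : ℕ)) = w ^ (r : ℕ) := fun r => by
    have h1 : w ^ d = w ^ (r : ℕ) * w ^ (d - (r : ℕ)) := by
      rw [← pow_add]; congr 1; omega
    rw [h1, inv_pow, mul_assoc, mul_inv_cancel₀ (pow_ne_zero _ hw), mul_one]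
  rw [centredPoly_eval, boettcherRemainder]
  simp only [scaledCoeff, mul_pow]
  have h2 : ∀ r : Fin (d - 1), w ^ d * (A r * w⁻¹ ^ (d - (r : ℕ)) * (1 + x) ^ (r : ℕ)) =
      A r * (w ^ (r : ℕ) * (1 + x) ^ (r : ℕ)) := fun r => by
    rw [← h r]; ring
  rw [mul_add, mul_add, mul_add, Finset.mul_sum]
  simp only [h2]
  ring

/-- The derivative of the remainder in `x` vanishes at `x = 0`, `c = 0`, since the linear term `d *
x` has been removed. Strict differentiability there gives any small Lipschitz constant, jointly in
`x` and `c`. -/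
theorem exists_boettcherRemainder_lipschitz (d : ℕ) :
    ∃ ε > 0, ε ≤ 1 / 2 ∧ ∃ ρ > 0, ∀ c : Fin (d - 1) → ℂ, ‖c‖ ≤ ρ → ∀ x y : ℂ, ‖x‖ ≤ ε → ‖y‖ ≤ ε →
      ‖boettcherRemainder d x c - boettcherRemainder d y c‖ ≤ 1 / 4 * ‖x - y‖ := by
  let g : ℂ × (Fin (d - 1) → ℂ) → ℂ := fun q => boettcherRemainder d q.1 q.2
  have hg : ContDiff ℂ 1 g := by
    simp only [g, boettcherRemainder]
    fun_prop
  have hs := hg.contDiffAt.hasStrictFDerivAt (x := (0, 0)) one_ne_zero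
  have h0 : ∀ v, fderiv ℂ g (0, 0) (v, 0) = 0 := by
    intro v
    have h1 : HasFDerivAt (fun x : ℂ => g (x, 0))
        ((fderiv ℂ g (0, 0)).comp (ContinuousLinearMap.inl ℂ ℂ (Fin (d - 1) → ℂ))) 0 :=
      HasFDerivAt.comp (g := g) (0 : ℂ) hs.hasFDerivAt (hasFDerivAt_prodMk_left 0 0)
    have h2 : HasDerivAt (fun x : ℂ => g (x, 0)) 0 0 := by
      have : HasDerivAt (fun x : ℂ => (1 + x) ^ d - 1 - d * x)
          ((d : ℂ) * (1 + 0) ^ (d - 1) * 1 - d * 1) 0 :=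
        ((((hasDerivAt_id (0 : ℂ)).const_add 1).pow d).sub_const 1).sub
          ((hasDerivAt_id (0 : ℂ)).const_mul (d : ℂ))
      simpa [g, boettcherRemainder] using this
    have h3 := h1.unique h2.hasFDerivAt
    have := congrArg (fun l : ℂ →L[ℂ] ℂ => l v) h3
    simpa using this
  have h1 := hs.isLittleO.def (c := 1 / 4) (by norm_num)
  obtain ⟨ε, hε, h⟩ := Metric.eventually_nhds_iff.1 h1
  refine ⟨min (ε / 2) (1 / 2), by positivity, min_le_right _ _, ε / 2, by positivity,
    fun c hc x y hx hy => ?_⟩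
  have hx' := hx.trans (min_le_left _ _)
  have hy' := hy.trans (min_le_left _ _)
  have h2 := @h ((x, c), (y, c)) (by
    simp only [Prod.dist_eq, dist_zero_right]
    refine max_lt (max_lt ?_ ?_) (max_lt ?_ ?_) <;> linarith)
  simpa [g, h0] using h2

theorem tendsto_scaledCoeff {d : ℕ} (A : Fin (d - 1) → ℂ) :
    Tendsto (scaledCoeff d A) (Bornology.cobounded ℂ) (𝓝 0) := by
  rw [tendsto_pi_nhds]
  intro r
  have h := ((tendsto_inv₀_cobounded (α := ℂ)).pow (d - (r : ℕ))).const_mul (A r)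
  rw [zero_pow (by omega), mul_zero] at h
  exact h

theorem tendsto_boettcherRemainder_zero {d : ℕ} (A : Fin (d - 1) → ℂ) :
    Tendsto (fun w => boettcherRemainder d 0 (scaledCoeff d A w)) (Bornology.cobounded ℂ) (𝓝 0) := by
  have hc : Continuous (boettcherRemainder d 0) := by
    unfold boettcherRemainder; fun_prop
  have h0 : boettcherRemainder d 0 0 = 0 := by simp [boettcherRemainder]
  have := (hc.tendsto 0).comp (tendsto_scaledCoeff A)
  rwa [h0] at this

theorem eventually_cobounded_iff_norm {p : ℂ → Prop} :
    (∀ᶠ w in Bornology.cobounded ℂ, p w) ↔ ∃ R : ℝ, ∀ w, R ≤ ‖w‖ → p w := by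
  rw [← comap_norm_atTop, eventually_comap, eventually_atTop]
  exact ⟨fun ⟨R, h⟩ => ⟨R, fun w hw => h _ hw w rfl⟩, fun ⟨R, h⟩ => ⟨R, fun b hb w hw => h w (hw ▸ hb)⟩⟩

/-- `ε` is a radius in which the functional equation of the Böttcher parametrization is a
contraction near infinity. -/
def IsContractionRadius (d : ℕ) (ε : ℝ) : Prop :=
  0 < ε ∧ ε ≤ 1 / 2 ∧ ∀ A : Fin (d - 1) → ℂ, ∃ R > 1, ∀ w : ℂ, R ≤ ‖w‖ →
    ‖boettcherRemainder d 0 (scaledCoeff d A w)‖ ≤ ε / 4 ∧ ∀ x y : ℂ, ‖x‖ ≤ ε → ‖y‖ ≤ ε →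
    ‖boettcherRemainder d x (scaledCoeff d A w) - boettcherRemainder d y (scaledCoeff d A w)‖ ≤
      1 / 4 * ‖x - y‖

theorem exists_isContractionRadius (d : ℕ) : ∃ ε, IsContractionRadius d ε := by
  obtain ⟨ε, hε, hε1, ρ, hρ, h⟩ := exists_boettcherRemainder_lipschitz d
  refine ⟨ε, hε, hε1, fun A => ?_⟩
  have h1 := (tendsto_scaledCoeff A).norm.eventually_le_const (u := ρ) (by simpa using hρ)
  have h2 := (tendsto_boettcherRemainder_zero A).norm.eventually_le_const (u := ε / 4)
    (by simpa using hε)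
  obtain ⟨R, hR⟩ := eventually_cobounded_iff_norm.1 (h1.and h2)
  refine ⟨max R 2, lt_max_of_lt_right one_lt_two, fun w hw => ?_⟩
  obtain ⟨h3, h4⟩ := hR w ((le_max_left _ _).trans hw)
  exact ⟨h4, h _ h3⟩

theorem le_norm_pow {R : ℝ} (hR : 1 ≤ R) {d : ℕ} (hd : d ≠ 0) {w : ℂ} (hw : R ≤ ‖w‖) :
    R ≤ ‖w ^ d‖ := by
  rw [norm_pow]
  exact hw.trans (le_self_pow₀ (hR.trans hw) hd)

/-- Iterating the inequality along `w ↦ w ^ d` wipes out the a priori bound `M` and leaves the fixed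
value `4 / 3 * τ`. The factor is `4 / 7 = 1 / (2 - 1 / 4)`: expansion by `d ≥ 2` against a remainder
of Lipschitz constant `1 / 4`. -/
theorem le_of_le_pow_invariant {d : ℕ} (hd : d ≠ 0) {R : ℝ} (hR : 1 ≤ R) {f : ℂ → ℝ} {M τ : ℝ}
    (hM : ∀ w, R ≤ ‖w‖ → f w ≤ M)
    (h : ∀ w, R ≤ ‖w‖ → f w ≤ 4 / 7 * (f (w ^ d) + τ)) {w : ℂ} (hw : R ≤ ‖w‖) :
    f w ≤ 4 / 3 * τ := by
  have key : ∀ n : ℕ, ∀ w, R ≤ ‖w‖ → f w - 4 / 3 * τ ≤ (4 / 7) ^ n * (M - 4 / 3 * τ) := by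
    intro n
    induction n with
    | zero => intro w hw; have := hM w hw; linarith
    | succ n ih =>
      intro w hw
      have h1 := ih _ (le_norm_pow hR hd hw)
      have h2 := h w hw
      rw [pow_succ]
      linarith
  have ht : Tendsto (fun n : ℕ => (4 / 7 : ℝ) ^ n * (M - 4 / 3 * τ)) atTop (𝓝 (0 * (M - 4 / 3 * τ))) :=
    (tendsto_pow_atTop_nhds_zero_of_lt_one (by norm_num) (by norm_num)).mul_const _
  have := ge_of_tendsto' ht fun n => key n w hw
  linarith

theorem boettcher_equation {d : ℕ} {A : Fin (d - 1) → ℂ} {Psi : ℂ → ℂ} {w : ℂ} (hw : w ≠ 0)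
    (h : Psi (w ^ d) = (centredPoly d A).eval (Psi w)) :
    Psi (w ^ d) / w ^ d - 1 =
      d * (Psi w / w - 1) + boettcherRemainder d (Psi w / w - 1) (scaledCoeff d A w) := by
  have h1 : Psi w = w * (1 + (Psi w / w - 1)) := by field_simp; ring
  rw [h, h1, centredPoly_eval_mul d A hw, ← h1, mul_div_cancel_left₀ _ (pow_ne_zero d hw)]
  ring

theorem exists_eqOn_far {d : ℕ} (hd : 2 ≤ d) {A : Fin (d - 1) → ℂ} {R : ℝ} {Psi Phi : ℂ → ℂ}
    (hPsi : IsBoettcherOn d (centredPoly d A) R Psi)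
    (hPhi : IsBoettcherOn d (centredPoly d A) R Phi) :
    ∃ R' : ℝ, ∀ w, R' ≤ ‖w‖ → Psi w = Phi w := by
  obtain ⟨ε, hε, hε1, hcon⟩ := exists_isContractionRadius d
  obtain ⟨R₁, hR₁, hrem⟩ := hcon A
  have hnear : ∀ {Psi : ℂ → ℂ}, IsBoettcherOn d (centredPoly d A) R Psi →
      ∀ᶠ w in Bornology.cobounded ℂ, ‖Psi w / w - 1‖ ≤ ε := fun h =>
    (h.tangent.sub_const 1).norm.eventually_le_const (u := ε) (by simpa using hε)
  obtain ⟨R₂, hR₂⟩ := eventually_cobounded_iff_norm.1 ((hnear hPsi).and (hnear hPhi))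
  have hd' : (2 : ℝ) ≤ d := by exact_mod_cast hd
  refine ⟨max R (max R₁ R₂), fun w hw => ?_⟩
  have hle := le_of_le_pow_invariant (d := d) (by omega) (R := max R (max R₁ R₂))
    (hR₁.le.trans ((le_max_left _ _).trans (le_max_right _ _)))
    (f := fun w => ‖(Psi w / w - 1) - (Phi w / w - 1)‖) (M := ε + ε) (τ := 0)
    (fun w hw => by
      obtain ⟨h1, h2⟩ := hR₂ w (((le_max_right _ _).trans (le_max_right _ _)).trans hw)
      exact (norm_sub_le _ _).trans (add_le_add h1 h2))
    (fun w hw => by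
      obtain ⟨h1, h2⟩ := hR₂ w (((le_max_right _ _).trans (le_max_right _ _)).trans hw)
      have hwR := (le_max_left _ _).trans hw
      have hwR₁ := ((le_max_left _ _).trans (le_max_right _ _)).trans hw
      have hw0 : w ≠ 0 := norm_pos_iff.1 (by linarith)
      have e1 := boettcher_equation hw0 (hPsi.conj w hwR)
      have e2 := boettcher_equation hw0 (hPhi.conj w hwR)
      have h3 := (hrem w hwR₁).2 _ _ h1 h2
      simp only [e1, e2]
      generalize Psi w / w - 1 = x at *
      generalize Phi w / w - 1 = y at *
      generalize boettcherRemainder d x (scaledCoeff d A w) = s at *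
      generalize boettcherRemainder d y (scaledCoeff d A w) = t at *
      have h4 : (d : ℂ) * (x - y) = (d * x + s - (d * y + t)) - (s - t) := by ring
      have h5 : (d : ℝ) * ‖x - y‖ ≤ ‖d * x + s - (d * y + t)‖ + ‖s - t‖ := by
        calc (d : ℝ) * ‖x - y‖ = ‖(d : ℂ) * (x - y)‖ := by simp
          _ ≤ _ := by rw [h4]; exact norm_sub_le _ _
      nlinarith [norm_nonneg (x - y)]) hw
  have hw0 : w ≠ 0 := norm_pos_iff.1 (by
    have := ((le_max_left _ _).trans (le_max_right _ _)).trans hw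
    linarith)
  have h0 : Psi w / w = Phi w / w := by
    have := norm_le_zero_iff.1 (hle.trans (by norm_num))
    linear_combination this
  field_simp at h0
  exact h0

/-- The functional equation improves mere closeness of `Psi w / w` to 1 into convergence, because
the remainder at `x = 0` tends to zero. Fixed points and implicit functions give closeness only, and
need this to recover the normalisation. -/
theorem IsContractionRadius.tangent {d : ℕ} (hd : 2 ≤ d) {ε : ℝ} (h : IsContractionRadius d ε)
    {A : Fin (d - 1) → ℂ} {R : ℝ} {Psi : ℂ → ℂ}
    (hconj : ∀ w, R ≤ ‖w‖ → Psi (w ^ d) = (centredPoly d A).eval (Psi w))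
    (hnear : ∀ w, R ≤ ‖w‖ → ‖Psi w / w - 1‖ ≤ ε) :
    Tendsto (fun w => Psi w / w) (Bornology.cobounded ℂ) (𝓝 1) := by
  obtain ⟨hε, hε1, hcon⟩ := h
  obtain ⟨R₁, hR₁, hrem⟩ := hcon A
  have hd' : (2 : ℝ) ≤ d := by exact_mod_cast hd
  rw [Metric.tendsto_nhds]
  intro τ hτ
  obtain ⟨R₂, hR₂⟩ := eventually_cobounded_iff_norm.1
    ((tendsto_boettcherRemainder_zero A).norm.eventually_le_const (u := τ / 2)
      (by simpa using hτ))
  refine eventually_cobounded_iff_norm.2 ⟨max R (max R₁ R₂), fun w hw => ?_⟩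
  have hle := le_of_le_pow_invariant (d := d) (by omega) (R := max R (max R₁ R₂))
    (hR₁.le.trans ((le_max_left _ _).trans (le_max_right _ _)))
    (f := fun w => ‖Psi w / w - 1‖) (M := ε) (τ := τ / 2)
    (fun w hw => hnear w ((le_max_left _ _).trans hw))
    (fun w hw => by
      have h1 := hnear w ((le_max_left _ _).trans hw)
      have hwR₁ := ((le_max_left _ _).trans (le_max_right _ _)).trans hw
      have hw0 : w ≠ 0 := norm_pos_iff.1 (by linarith)
      have e1 := boettcher_equation hw0 (hconj w ((le_max_left _ _).trans hw))
      have h2 := hR₂ w (((le_max_right _ _).trans (le_max_right _ _)).trans hw)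
      have h3 := (hrem w hwR₁).2 _ 0 h1 (by simpa using hε.le)
      simp only [e1]
      generalize Psi w / w - 1 = x at *
      generalize boettcherRemainder d x (scaledCoeff d A w) = s at *
      generalize boettcherRemainder d 0 (scaledCoeff d A w) = t at *
      rw [sub_zero] at h3
      have h4 : (d : ℂ) * x = (d * x + s) - (s - t) - t := by ring
      have h5 : (d : ℝ) * ‖x‖ ≤ ‖(d : ℂ) * x + s‖ + ‖s - t‖ + ‖t‖ := by
        have h8 : (d : ℝ) * ‖x‖ = ‖(d : ℂ) * x‖ := by simp
        rw [h8]
        have h6 := norm_sub_le (d * x + s) (s - t)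
        have h7 := norm_sub_le (d * x + s - (s - t)) t
        rw [← h4] at h7
        linarith
      nlinarith [norm_nonneg x]) hw
  rw [dist_eq_norm]
  linarith
open scoped BoundedContinuousFunction

/-- The complement of the open disk of radius `R`. -/
abbrev OutsideDisk (R : ℝ) : Type := {w : ℂ // R ≤ ‖w‖}

/-- The power map on the complement of a disk. -/
def OutsideDisk.powMap {R : ℝ} (hR : 1 ≤ R) {d : ℕ} (hd : d ≠ 0) :
    C(OutsideDisk R, OutsideDisk R) :=
  ⟨fun w => ⟨(w : ℂ) ^ d, le_norm_pow hR hd w.2⟩, by fun_prop⟩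

theorem OutsideDisk.norm_inv_pow_le {R : ℝ} (hR : 1 ≤ R) (w : OutsideDisk R) (n : ℕ) :
    ‖((w : ℂ)⁻¹) ^ n‖ ≤ 1 := by
  rw [norm_pow, norm_inv]
  exact pow_le_one₀ (by positivity) (inv_le_one_of_one_le₀ (hR.trans w.2))

theorem OutsideDisk.ne_zero {R : ℝ} (hR : 1 ≤ R) (w : OutsideDisk R) : (w : ℂ) ≠ 0 :=
  norm_pos_iff.1 (by linarith [w.2])

/-- The function `w ↦ w⁻¹ ^ n` on the complement of a disk. -/
noncomputable def OutsideDisk.invPow {R : ℝ} (hR : 1 ≤ R) (n : ℕ) : OutsideDisk R →ᵇ ℂ :=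
  BoundedContinuousFunction.ofNormedAddCommGroup (fun w => ((w : ℂ)⁻¹) ^ n)
    ((continuous_subtype_val.inv₀ (OutsideDisk.ne_zero hR)).pow n) 1
    fun w => OutsideDisk.norm_inv_pow_le hR w n

theorem exists_isBoettcherOn_far {d : ℕ} (hd : 2 ≤ d) (A : Fin (d - 1) → ℂ) :
    ∃ R > 1, ∃ Psi, IsBoettcherOn d (centredPoly d A) R Psi := by
  obtain ⟨ε, hε0⟩ := exists_isContractionRadius d
  obtain ⟨hε, hε1, hcon⟩ := id hε0
  obtain ⟨R, hR, hrem⟩ := hcon A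
  have hd0 : d ≠ 0 := by omega
  have hd' : (2 : ℝ) ≤ d := by exact_mod_cast hd
  have hdc : (d : ℂ) ≠ 0 := by exact_mod_cast hd0
  let σ := OutsideDisk.powMap hR.le hd0
  -- Writing `Psi w = w * (1 + u w)`, the equation is solved for the linear term `d * u`. Division
  -- by `d ≥ 2` gives the contraction factor `(1 + 1 / 4) / 2 = 5 / 8`.
  let T : (OutsideDisk R →ᵇ ℂ) → (OutsideDisk R →ᵇ ℂ) := fun u =>
    (d : ℂ)⁻¹ • (u.compContinuous σ - ((1 + u) ^ d - 1 - (d : ℂ) • u +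
      ∑ r : Fin (d - 1), A r • (OutsideDisk.invPow hR.le (d - (r : ℕ)) * (1 + u) ^ (r : ℕ))))
  have hT : ∀ u w, T u w =
      (d : ℂ)⁻¹ * (u (σ w) - boettcherRemainder d (u w) (scaledCoeff d A w)) := by
    intro u w
    simp [T, boettcherRemainder, scaledCoeff, OutsideDisk.invPow, mul_assoc]
  have hball : ∀ {u : OutsideDisk R →ᵇ ℂ}, u ∈ Metric.closedBall (0 : OutsideDisk R →ᵇ ℂ) ε →
      ∀ w, ‖u w‖ ≤ ε := fun {u} hu w => (u.norm_coe_le_norm w).trans (by simpa using hu)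
  have hlip : ∀ u ∈ Metric.closedBall (0 : OutsideDisk R →ᵇ ℂ) ε,
      ∀ v ∈ Metric.closedBall (0 : OutsideDisk R →ᵇ ℂ) ε, dist (T u) (T v) ≤ 5 / 8 * dist u v := by
    intro u hu v hv
    rw [BoundedContinuousFunction.dist_le (by positivity)]
    intro w
    rw [hT, hT, dist_eq_norm, ← mul_sub, norm_mul, norm_inv, Complex.norm_natCast]
    have h1 := (hrem w w.2).2 _ _ (hball hu w) (hball hv w)
    have h2 : ‖u w - v w‖ ≤ dist u v := by
      rw [← dist_eq_norm]; exact BoundedContinuousFunction.dist_coe_le_dist w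
    have h3 : ‖u (σ w) - v (σ w)‖ ≤ dist u v := by
      rw [← dist_eq_norm]; exact BoundedContinuousFunction.dist_coe_le_dist (σ w)
    generalize boettcherRemainder d (u w) (scaledCoeff d A w) = s at *
    generalize boettcherRemainder d (v w) (scaledCoeff d A w) = t at *
    have h4 : ‖u (σ w) - s - (v (σ w) - t)‖ ≤ dist u v + 1 / 4 * dist u v := by
      calc _ = ‖(u (σ w) - v (σ w)) - (s - t)‖ := by congr 1; ring
        _ ≤ _ := (norm_sub_le _ _).trans (by linarith)
    calc _ ≤ (2 : ℝ)⁻¹ * (dist u v + 1 / 4 * dist u v) := by gcongr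
      _ = _ := by ring
  have hT0 : ‖T 0‖ ≤ 1 / 8 * ε := by
    refine BoundedContinuousFunction.norm_le (by positivity) |>.2 fun w => ?_
    have h1 := (hrem w w.2).1
    rw [hT, norm_mul, norm_inv, Complex.norm_natCast]
    simp only [BoundedContinuousFunction.coe_zero, Pi.zero_apply, zero_sub, norm_neg]
    calc _ ≤ (2 : ℝ)⁻¹ * (ε / 4) := by gcongr
      _ = _ := by ring
  have h00 : (0 : OutsideDisk R →ᵇ ℂ) ∈ Metric.closedBall (0 : OutsideDisk R →ᵇ ℂ) ε :=
    Metric.mem_closedBall_self hε.le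
  have hmaps : MapsTo T (Metric.closedBall 0 ε) (Metric.closedBall 0 ε) := by
    intro u hu
    have h1 := hlip u hu 0 h00
    rw [Metric.mem_closedBall] at hu ⊢
    have h2 := dist_triangle (T u) (T 0) 0
    rw [dist_zero_right (T 0)] at h2
    linarith
  have hcontr : ContractingWith (5 / 8) (hmaps.restrict T _ _) := by
    refine ⟨by rw [← NNReal.coe_lt_coe]; norm_num, LipschitzWith.of_dist_le_mul fun u v => ?_⟩
    have := hlip u u.2 v v.2
    simpa [Subtype.dist_eq] using this
  obtain ⟨u, hu, hfix, -⟩ := hcontr.exists_fixedPoint' Metric.isClosed_closedBall.isComplete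
    hmaps h00 (edist_ne_top _ _)
  classical
  let Psi : ℂ → ℂ := fun w => if h : R ≤ ‖w‖ then w * (1 + u ⟨w, h⟩) else 0
  have hPsi : ∀ w : OutsideDisk R, Psi w = w * (1 + u w) := fun w => dif_pos w.2
  have hconj : ∀ w : ℂ, R ≤ ‖w‖ → Psi (w ^ d) = (centredPoly d A).eval (Psi w) := by
    intro w hw
    have h1 := hPsi ⟨w, hw⟩
    have h2 := hPsi (σ ⟨w, hw⟩)
    have h3 := hT u ⟨w, hw⟩
    rw [hfix.eq] at h3
    change Psi (w ^ d) = w ^ d * _ at h2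
    dsimp only at h1 h3
    rw [h1, h2, centredPoly_eval_mul d A (OutsideDisk.ne_zero hR.le ⟨w, hw⟩)]
    rw [eq_inv_mul_iff_mul_eq₀ hdc] at h3
    congr 2
    linear_combination -h3
  refine ⟨R, hR, Psi, ?_, hconj, ?_⟩
  · rw [continuousOn_iff_continuous_domRestrict]
    have : ({w : ℂ | R ≤ ‖w‖}.domRestrict Psi) = fun w : OutsideDisk R => (w : ℂ) * (1 + u w) :=
      funext fun w => hPsi w
    rw [this]
    fun_prop
  · refine hε0.tangent hd hconj fun w hw => ?_
    have h1 := hPsi ⟨w, hw⟩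
    dsimp only at h1
    rw [h1, mul_div_cancel_left₀ _ (OutsideDisk.ne_zero hR.le ⟨w, hw⟩), add_sub_cancel_left]
    exact hball hu _

/-! ### Continuation to the exterior of the closed unit disk by covering theory. -/

theorem conj_iterate {d : ℕ} (hd : d ≠ 0) {P : Polynomial ℂ} {R : ℝ} (hR : 1 ≤ R) {Psi : ℂ → ℂ}
    (h : ∀ w : ℂ, R ≤ ‖w‖ → Psi (w ^ d) = P.eval (Psi w)) (n : ℕ) {w : ℂ} (hw : R ≤ ‖w‖) :
    Psi (w ^ d ^ n) = polyIter P n (Psi w) := by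
  induction n generalizing w with
  | zero => simp [polyIter_zero]
  | succ n ih =>
    rw [pow_succ', pow_mul, ih (le_norm_pow hR hd hw), h w hw, polyIter_succ]

theorem tendsto_norm_pow_pow {d : ℕ} (hd : 2 ≤ d) {x : ℝ} (hx : 1 < x) :
    Tendsto (fun n : ℕ => x ^ d ^ n) atTop atTop :=
  (tendsto_pow_atTop_atTop_of_one_lt hx).comp (tendsto_pow_atTop_atTop_of_one_lt (by omega : 1 < d))

namespace IsBoettcherOn

theorem mem_basinInfinity {d : ℕ} (hd : 2 ≤ d) {P : Polynomial ℂ} {R : ℝ} (hR : 1 < R)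
    {Psi : ℂ → ℂ} (h : IsBoettcherOn d P R Psi) {w : ℂ} (hw : R ≤ ‖w‖) :
    Psi w ∈ basinInfinity P := by
  simp only [basinInfinity, mem_ofPred_eq,
    ← conj_iterate (by omega) hR.le h.conj _ hw]
  have h1 : Tendsto Psi (Bornology.cobounded ℂ) (Bornology.cobounded ℂ) := by
    rw [← tendsto_norm_atTop_iff_cobounded]
    have h2 := h.tangent.norm.eventually_const_le (u := 1 / 2) (by norm_num)
    have h3 : Tendsto (fun w : ℂ => 1 / 2 * ‖w‖) (Bornology.cobounded ℂ) atTop :=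
      tendsto_norm_cobounded_atTop.const_mul_atTop (by norm_num)
    refine tendsto_atTop_mono' _ ?_ h3
    filter_upwards [h2, tendsto_norm_cobounded_atTop.eventually_gt_atTop 0] with v hv hv0
    rw [norm_div, le_div_iff₀ hv0] at hv
    exact hv
  refine h1.comp ?_
  rw [← tendsto_norm_atTop_iff_cobounded]
  simp only [norm_pow]
  exact tendsto_norm_pow_pow hd (hR.trans_le hw)

section Lift

variable {d : ℕ} (hd : 2 ≤ d) {A : Fin (d - 1) → ℂ}
  (hb : HasBoundedCriticalOrbits (centredPoly d A))

/-- The complement of the set of critical values. -/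
def _root_.regularValues (P : Polynomial ℂ) : Set ℂ :=
  (P.eval '' {k | P.derivative.eval k = 0})ᶜ

theorem _root_.isCoveringMap_regularValues (P : Polynomial ℂ) :
    IsCoveringMap ((regularValues P).restrictPreimage fun z => P.eval z) :=
  P.isCoveringMapOn_eval.isCoveringMap_restrictPreimage

include hb in
theorem _root_.mem_regularValues_of_mem_basinInfinity {z : ℂ}
    (hz : z ∈ basinInfinity (centredPoly d A)) : z ∈ regularValues (centredPoly d A) := by
  rintro ⟨k, hk, rfl⟩
  exact mem_filledJulia_of_critical hb hk ((eval_mem_basinInfinity_iff _).1 hz)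

include hb in
theorem _root_.eval_mem_regularValues_of_mem_basinInfinity {z : ℂ}
    (hz : z ∈ basinInfinity (centredPoly d A)) :
    (centredPoly d A).eval z ∈ regularValues (centredPoly d A) :=
  mem_regularValues_of_mem_basinInfinity hb ((eval_mem_basinInfinity_iff _).2 hz)

include hd hb

/-- Along the ray from `w` to infinity both functions lift the same path through `P`, which is a
covering there because the basin contains no critical values. They agree far out, hence at `w`;
induction on `k` supplies equality of the paths downstairs. -/
theorem eqOn {R : ℝ} (hR : 1 < R) {Psi Phi : ℂ → ℂ}
    (hPsi : IsBoettcherOn d (centredPoly d A) R Psi)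
    (hPhi : IsBoettcherOn d (centredPoly d A) R Phi) {w : ℂ} (hw : R ≤ ‖w‖) : Psi w = Phi w := by
  obtain ⟨R', hR'⟩ := exists_eqOn_far hd hPsi hPhi
  have key : ∀ k : ℕ, ∀ w : ℂ, R ≤ ‖w‖ → R' ≤ ‖w‖ ^ d ^ k → Psi w = Phi w := by
    intro k
    induction k with
    | zero => intro w _ h; exact hR' w (by simpa using h)
    | succ k ih =>
      intro w hw hk
      have hnorm : ∀ t : Ici (1 : ℝ), ‖w‖ ≤ ‖((t : ℝ) : ℂ) * w‖ := fun t => by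
        have ht : (1 : ℝ) ≤ t := t.2
        rw [norm_mul, Complex.norm_real, Real.norm_of_nonneg (by linarith)]
        exact le_mul_of_one_le_left (norm_nonneg _) ht
      have hlift : ∀ {Psi : ℂ → ℂ}, IsBoettcherOn d (centredPoly d A) R Psi →
          ∀ t : Ici (1 : ℝ), Psi (((t : ℝ) : ℂ) * w) ∈
            (fun z => (centredPoly d A).eval z) ⁻¹' regularValues (centredPoly d A) := fun h t =>
        eval_mem_regularValues_of_mem_basinInfinity hb (h.mem_basinInfinity hd hR (hw.trans (hnorm t)))
      have hcont : ∀ {Psi : ℂ → ℂ}, IsBoettcherOn d (centredPoly d A) R Psi →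
          Continuous fun t : Ici (1 : ℝ) => Psi (((t : ℝ) : ℂ) * w) := fun h =>
        h.continuousOn.comp_continuous (by fun_prop) fun t => hw.trans (hnorm t)
      have : PreconnectedSpace (Ici (1 : ℝ)) := Subtype.preconnectedSpace isPreconnected_Ici
      let g₁ : Ici (1 : ℝ) → (fun z => (centredPoly d A).eval z) ⁻¹' regularValues (centredPoly d A) :=
        fun t => ⟨Psi (((t : ℝ) : ℂ) * w), hlift hPsi t⟩
      let g₂ : Ici (1 : ℝ) → (fun z => (centredPoly d A).eval z) ⁻¹' regularValues (centredPoly d A) :=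
        fun t => ⟨Phi (((t : ℝ) : ℂ) * w), hlift hPhi t⟩
      have heq : g₁ = g₂ := by
        refine (isCoveringMap_regularValues (centredPoly d A)).eq_of_comp_eq
          ((hcont hPsi).subtype_mk _) ((hcont hPhi).subtype_mk _) ?_
          (⟨max 1 R', mem_Ici.2 (le_max_left _ _)⟩ : Ici (1 : ℝ)) ?_
        · funext t
          refine Subtype.ext ?_
          change (centredPoly d A).eval (Psi (((t : ℝ) : ℂ) * w)) =
            (centredPoly d A).eval (Phi (((t : ℝ) : ℂ) * w))
          have ht := hw.trans (hnorm t)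
          rw [← hPsi.conj _ ht, ← hPhi.conj _ ht]
          refine ih _ (le_norm_pow hR.le (by omega) ht) ?_
          rw [norm_pow, ← pow_mul, ← pow_succ']
          exact hk.trans (pow_le_pow_left₀ (norm_nonneg _) (hnorm t) _)
        · refine Subtype.ext (hR' _ ?_)
          rw [norm_mul, Complex.norm_real, Real.norm_of_nonneg (by positivity)]
          exact (le_max_right 1 R').trans (le_mul_of_one_le_right (by positivity) (by linarith))
      have := congrArg Subtype.val (congrFun heq ⟨1, mem_Ici.2 le_rfl⟩)
      simpa [g₁, g₂] using this
  obtain ⟨k, hk⟩ := ((tendsto_norm_pow_pow hd (hR.trans_le hw)).eventually_ge_atTop R').exists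
  exact key k w hw hk

/-- Shrinking the factor `s` from `ρ ^ d` to 1 gives a homotopy `Psi ((s w) ^ d)` whose initial map
is lifted by `Psi (s w)`. The end of the lifted homotopy is the extension, so no simple
connectedness is required. -/
theorem exists_extension {ρ : ℝ} (hρ : 1 < ρ) {Psi : ℂ → ℂ}
    (h : IsBoettcherOn d (centredPoly d A) (ρ ^ d) Psi) :
    ∃ Phi, IsBoettcherOn d (centredPoly d A) ρ Phi := by
  set P := centredPoly d A with hP
  have hR : 1 < ρ ^ d := one_lt_pow₀ hρ (by omega)
  have hρR : ρ ≤ ρ ^ d := le_self_pow₀ hρ.le (by omega)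
  let s : unitInterval → ℝ := fun t => 1 + (1 - (t : ℝ)) * (ρ ^ d - 1)
  have hs : Continuous s := by fun_prop
  have hs1 : ∀ t, 1 ≤ s t := fun t => by
    have := t.2.2
    have : 0 ≤ (1 - (t : ℝ)) * (ρ ^ d - 1) := mul_nonneg (by linarith) (by linarith)
    simp only [s]; linarith
  have hnorm : ∀ t (w : ℂ), ‖w‖ ≤ ‖(s t : ℂ) * w‖ := fun t w => by
    rw [norm_mul, Complex.norm_real, Real.norm_of_nonneg (by linarith [hs1 t])]
    exact le_mul_of_one_le_left (norm_nonneg _) (hs1 t)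
  have hpow : ∀ t (w : OutsideDisk ρ), ρ ^ d ≤ ‖((s t : ℂ) * w) ^ d‖ := fun t w => by
    rw [norm_pow]
    exact pow_le_pow_left₀ (by linarith) (w.2.trans (hnorm t w)) _
  have hfar : ∀ w : OutsideDisk ρ, ρ ^ d ≤ ‖(s 0 : ℂ) * w‖ := fun w => by
    have hs0 : s 0 = ρ ^ d := by simp [s]
    rw [hs0, norm_mul, Complex.norm_real, Real.norm_of_nonneg (by linarith)]
    exact le_mul_of_one_le_right (by linarith) (by linarith [w.2])
  have cov := isCoveringMap_regularValues P
  have hHc : Continuous fun q : unitInterval × OutsideDisk ρ => Psi (((s q.1 : ℂ) * q.2) ^ d) :=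
    h.continuousOn.comp_continuous (f := fun q : unitInterval × OutsideDisk ρ => ((s q.1 : ℂ) * q.2) ^ d)
      (by fun_prop) fun q => hpow q.1 q.2
  have hfc : Continuous fun w : OutsideDisk ρ => Psi ((s 0 : ℂ) * w) :=
    h.continuousOn.comp_continuous (f := fun w : OutsideDisk ρ => (s 0 : ℂ) * w)
      (by fun_prop) hfar
  have hHm : ∀ q : unitInterval × OutsideDisk ρ, Psi (((s q.1 : ℂ) * q.2) ^ d) ∈ regularValues P := fun q =>
    mem_regularValues_of_mem_basinInfinity hb (h.mem_basinInfinity hd hR (hpow _ _))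
  have hfm : ∀ w : OutsideDisk ρ, Psi ((s 0 : ℂ) * w) ∈ (fun z => P.eval z) ⁻¹' regularValues P :=
    fun w => eval_mem_regularValues_of_mem_basinInfinity hb (h.mem_basinInfinity hd hR (hfar w))
  obtain ⟨G, hG, hG0⟩ : ∃ G : C(unitInterval × OutsideDisk ρ, (fun z => P.eval z) ⁻¹' regularValues P),
      (∀ t w, P.eval (G (t, w)).1 = Psi (((s t : ℂ) * w) ^ d)) ∧
      ∀ w, (G (0, w)).1 = Psi ((s 0 : ℂ) * w) := by
    let H : C(unitInterval × OutsideDisk ρ, regularValues P) := ⟨_, hHc.subtype_mk hHm⟩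
    let f : C(OutsideDisk ρ, (fun z => P.eval z) ⁻¹' regularValues P) := ⟨_, hfc.subtype_mk hfm⟩
    have H0 : ∀ w, H (0, w) = (regularValues P).restrictPreimage (fun z => P.eval z) (f w) :=
      fun w => Subtype.ext (h.conj _ (hfar w))
    exact ⟨cov.liftHomotopy H f H0,
      fun t w => congrArg Subtype.val (congrFun (cov.liftHomotopy_lifts H f H0) (t, w)),
      fun w => congrArg Subtype.val (cov.liftHomotopy_zero H f H0 w)⟩
  have hagree : ∀ w (hw : ρ ^ d ≤ ‖w‖), (G (1, ⟨w, hρR.trans hw⟩) : ℂ) = Psi w := by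
    intro w hw
    let g₂ : unitInterval → (fun z => P.eval z) ⁻¹' regularValues P := fun t => ⟨Psi ((s t : ℂ) * w),
      eval_mem_regularValues_of_mem_basinInfinity hb
        (h.mem_basinInfinity hd hR (hw.trans (hnorm t w)))⟩
    have heq : (fun t => G (t, ⟨w, hρR.trans hw⟩)) = g₂ := by
      have hc : Continuous fun t : unitInterval => Psi ((s t : ℂ) * w) :=
        h.continuousOn.comp_continuous (f := fun t : unitInterval => (s t : ℂ) * w) (by fun_prop)
          fun t => hw.trans (hnorm t w)
      refine cov.eq_of_comp_eq (by fun_prop) (hc.subtype_mk _)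
        (funext fun t => Subtype.ext ?_) 0 (Subtype.ext (hG0 _))
      exact (hG t _).trans (h.conj _ (hw.trans (hnorm t w)))
    have := congrArg Subtype.val (congrFun heq 1)
    simpa [g₂, s] using this
  classical
  let Phi : ℂ → ℂ := fun w => if hw : ρ ≤ ‖w‖ then G (1, ⟨w, hw⟩) else 0
  have hPhi : ∀ w : OutsideDisk ρ, Phi w = G (1, w) := fun w => dif_pos w.2
  have hPhiPsi : ∀ w, ρ ^ d ≤ ‖w‖ → Phi w = Psi w := fun w hw =>
    (hPhi ⟨w, hρR.trans hw⟩).trans (hagree w hw)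
  refine ⟨Phi, ?_, fun w hw => ?_, ?_⟩
  · rw [continuousOn_iff_continuous_domRestrict]
    have : ({w : ℂ | ρ ≤ ‖w‖}.domRestrict Phi) = fun w : OutsideDisk ρ => (G (1, w) : ℂ) :=
      funext fun w => hPhi w
    rw [this]
    fun_prop
  · have hwd : ρ ^ d ≤ ‖w ^ d‖ := by
      rw [norm_pow]
      exact pow_le_pow_left₀ (by linarith) hw _
    have h1 := hG 1 ⟨w, hw⟩
    rw [hPhiPsi _ hwd, hPhi ⟨w, hw⟩, h1]
    simp [s]
  · refine h.tangent.congr' ?_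
    filter_upwards [tendsto_norm_cobounded_atTop.eventually_ge_atTop (ρ ^ d)] with w hw
    rw [hPhiPsi w hw]

theorem exists_of_one_lt {ρ : ℝ} (hρ : 1 < ρ) :
    ∃ Psi, IsBoettcherOn d (centredPoly d A) ρ Psi := by
  obtain ⟨R, hR, Psi, hPsi⟩ := exists_isBoettcherOn_far hd A
  obtain ⟨n, hn⟩ := ((tendsto_norm_pow_pow hd hρ).eventually_ge_atTop R).exists
  induction n generalizing ρ with
  | zero => exact ⟨Psi, hPsi.mono (by simpa using hn)⟩
  | succ n ih =>
    obtain ⟨Phi, hPhi⟩ := ih (ρ := ρ ^ d) (one_lt_pow₀ hρ (by omega))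
      (by rwa [← pow_mul, ← pow_succ'])
    exact exists_extension hd hb hρ hPhi

theorem exists_forall_one_lt :
    ∃ Psi, ∀ ρ > 1, IsBoettcherOn d (centredPoly d A) ρ Psi := by
  choose! F hF using fun (ρ : ℝ) (hρ : 1 < ρ) => exists_of_one_lt hd hb hρ
  -- By uniqueness the solutions for different radii agree on their common domain, so each point may
  -- use its own modulus as the radius.
  refine ⟨fun w => F ‖w‖ w, fun ρ hρ => ?_⟩
  have heq : ∀ w, ρ ≤ ‖w‖ → F ‖w‖ w = F ρ w := fun w hw =>
    eqOn hd hb (hρ.trans_le hw) (hF _ (hρ.trans_le hw)) ((hF ρ hρ).mono hw) le_rfl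
  refine ⟨(hF ρ hρ).continuousOn.congr heq, fun w hw => ?_, ?_⟩
  · rw [heq w hw, heq _ (le_norm_pow hρ.le (by omega) hw), (hF ρ hρ).conj w hw]
  · refine (hF ρ hρ).tangent.congr' ?_
    filter_upwards [tendsto_norm_cobounded_atTop.eventually_ge_atTop ρ] with w hw
    rw [heq w hw]

end Lift

end IsBoettcherOn

/-! ### Continuous extension to the unit circle. -/

theorem subset_closure_one_lt_norm : {w : ℂ | 1 ≤ ‖w‖} ⊆ closure {w : ℂ | 1 < ‖w‖} := by
  have h1 : {w : ℂ | 1 < ‖w‖} = (Metric.closedBall 0 1)ᶜ := by ext; simp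
  rw [h1, closure_compl, interior_closedBall _ one_ne_zero]
  intro w hw
  simpa using hw

theorem IsBoettcherParam.eqOn {d : ℕ} (hd : 2 ≤ d) {A : Fin (d - 1) → ℂ}
    (hb : HasBoundedCriticalOrbits (centredPoly d A)) {Psi Phi : ℂ → ℂ}
    (hPsi : IsBoettcherParam d (centredPoly d A) Psi)
    (hPhi : IsBoettcherParam d (centredPoly d A) Phi) : EqOn Psi Phi {w | 1 ≤ ‖w‖} := by
  refine EqOn.of_subset_closure (s := {w : ℂ | 1 < ‖w‖}) (fun w hw => ?_) hPsi.continuousOn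
    hPhi.continuousOn (fun w (hw : 1 < ‖w‖) => hw.le) subset_closure_one_lt_norm
  exact IsBoettcherOn.eqOn hd hb (R := ‖w‖) hw ((isBoettcherOn_one_iff.2 hPsi).mono (le_of_lt hw))
    ((isBoettcherOn_one_iff.2 hPhi).mono (le_of_lt hw)) le_rfl

section Boundary

variable {d : ℕ} (hd : 2 ≤ d) {A : Fin (d - 1) → ℂ} (hA : ∀ r, ‖A r‖ ≤ 1) {Psi : ℂ → ℂ}
  (hPsi : ∀ ρ > 1, IsBoettcherOn d (centredPoly d A) ρ Psi)
include hd hA hPsi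

/-- The first power `w ^ d ^ n` of modulus at least 2 lies in a compact annulus, where `Psi` is
bounded. Outside the disk of radius 3 the modulus does not decrease under iteration, so the bound
passes back to `Psi w`. -/
theorem exists_norm_le_of_norm_le_two :
    ∃ M : ℝ, 3 ≤ M ∧ ∀ w : ℂ, 1 < ‖w‖ → ‖w‖ ≤ 2 → ‖Psi w‖ ≤ M := by
  have hcomp : IsCompact (Metric.closedBall (0 : ℂ) (2 ^ d) ∩ {w : ℂ | 2 ≤ ‖w‖}) :=
    (isCompact_closedBall 0 _).inter_right (isClosed_le continuous_const continuous_norm)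
  obtain ⟨M, hM⟩ := hcomp.exists_bound_of_continuousOn
    ((hPsi 2 (by norm_num)).continuousOn.mono inter_subset_right)
  refine ⟨max 3 M, le_max_left _ _, fun w hw hw2 => ?_⟩
  have hex : ∃ n : ℕ, 2 ≤ ‖w‖ ^ d ^ n :=
    ((tendsto_norm_pow_pow hd hw).eventually_ge_atTop 2).exists
  classical
  have hle : ‖w‖ ^ d ^ Nat.find hex ≤ 2 ^ d := by
    rcases Nat.eq_zero_or_pos (Nat.find hex) with h0 | hpos
    · rw [h0]
      simpa using hw2.trans (le_self_pow₀ one_le_two (by omega))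
    · obtain ⟨m, hm⟩ := Nat.exists_eq_succ_of_ne_zero hpos.ne'
      have h1 := Nat.find_min hex (m := m) (by omega)
      rw [hm, Nat.succ_eq_add_one, pow_succ, pow_mul]
      exact pow_le_pow_left₀ (by positivity) (not_le.1 h1).le _
  by_contra! hcon
  have h3 : 3 ≤ ‖Psi w‖ := (le_max_left _ _).trans hcon.le
  have h4 := norm_le_polyIter hd hA h3 (Nat.find hex)
  rw [← conj_iterate (by omega) hw.le (hPsi _ hw).conj _ le_rfl] at h4
  have h5 := hM (w ^ d ^ Nat.find hex)
    ⟨by simpa using hle, by simpa using Nat.find_spec hex⟩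
  linarith [le_max_right 3 M]

/-- The part of the basin in a large disk and away from the Julia set escapes within a uniform
number `n` of steps. For `‖w‖` close to 1 the point `w ^ d ^ n` still has modulus below 2, so `Psi
w` has not escaped by then. -/
theorem exists_radius_near_juliaSet {ε : ℝ} (hε : 0 < ε) :
    ∃ ρ > 1, ∀ w : ℂ, 1 < ‖w‖ → ‖w‖ < ρ → ∃ y ∈ juliaSet (centredPoly d A), dist (Psi w) y < ε := by
  set P := centredPoly d A with hP
  obtain ⟨M, hM3, hM⟩ := exists_norm_le_of_norm_le_two hd hA hPsi
  have hKc : IsClosed (filledJulia P) := isClosed_filledJulia hd hA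
  have hS : IsCompact (Metric.closedBall (0 : ℂ) M \
      (interior (filledJulia P) ∪ Metric.thickening ε (juliaSet P))) :=
    (isCompact_closedBall 0 M).diff (isOpen_interior.union Metric.isOpen_thickening)
  obtain ⟨n, hn⟩ := hS.elim_directed_cover (fun n => {z | M < ‖polyIter P n z‖})
    (fun n => isOpen_lt continuous_const (continuous_polyIter P n).norm)
    (fun z hz => by
      have hzb : z ∈ basinInfinity P := by
        by_contra hzK
        refine hz.2 (or_iff_not_imp_left.2 fun hi => Metric.self_subset_thickening hε _ ?_)
        rw [juliaSet, hKc.frontier_eq]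
        exact ⟨hzK, hi⟩
      have : Tendsto (fun n => ‖polyIter P n z‖) atTop atTop :=
        tendsto_norm_atTop_iff_cobounded.2 hzb
      exact mem_iUnion.2 (this.eventually_gt_atTop M).exists)
    (directed_of_isDirected_le (monotone_nat_of_le_succ fun n z (hz : M < _) => by
      have h3 : 3 ≤ ‖polyIter P n z‖ := hM3.trans hz.le
      have := two_mul_norm_le_eval hd hA h3
      change M < ‖polyIter P (n + 1) z‖
      rw [polyIter_succ']
      linarith))
  have hcont : Tendsto (fun r : ℝ => r ^ d ^ n) (𝓝 1) (𝓝 1) := by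
    have : Continuous fun r : ℝ => r ^ d ^ n := by fun_prop
    simpa using this.tendsto 1
  obtain ⟨δ, hδ, hδ2⟩ := Metric.eventually_nhds_iff.1
    (hcont.eventually_lt_const (by norm_num : (1 : ℝ) < 2))
  refine ⟨min (1 + δ) 2, lt_min (by linarith) one_lt_two, fun w hw hwρ => ?_⟩
  have hpow : ‖w‖ ^ d ^ n < 2 := hδ2 (by
    rw [Real.dist_eq, abs_of_pos (by linarith)]
    linarith [hwρ.trans_le (min_le_left _ _)])
  have hnot : Psi w ∉ {z | M < ‖polyIter P n z‖} := by
    have h1 := hM (w ^ d ^ n) (by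
      rw [norm_pow]; exact one_lt_pow₀ hw (pow_ne_zero _ (by omega))) (by
      rw [norm_pow]; exact hpow.le)
    rw [conj_iterate (by omega) hw.le (hPsi _ hw).conj _ le_rfl] at h1
    simpa using h1
  have hb : Psi w ∈ basinInfinity P := (hPsi _ hw).mem_basinInfinity hd hw le_rfl
  have hmem : Psi w ∈ Metric.thickening ε (juliaSet P) := by
    by_contra hth
    refine hnot (hn ⟨?_, fun h => h.elim (fun hi => interior_subset hi hb) hth⟩)
    simpa using hM w hw (hwρ.trans_le (min_le_right _ _)).le
  exact Metric.mem_thickening_iff.1 hmem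

end Boundary

/-- The point `exp (D ^ (-t)) v`, which tends to `v` as `t` tends to infinity. -/
noncomputable def radialPt (D : ℕ) (t : ℝ) (v : ℂ) : ℂ :=
  (Real.exp ((D : ℝ) ^ (-t)) : ℂ) * v

theorem norm_radialPt (D : ℕ) (t : ℝ) {v : ℂ} (hv : ‖v‖ = 1) :
    ‖radialPt D t v‖ = Real.exp ((D : ℝ) ^ (-t)) := by
  rw [radialPt, norm_mul, hv, mul_one, Complex.norm_real, Real.norm_of_nonneg (Real.exp_pos _).le]

theorem one_lt_norm_radialPt {D : ℕ} (hD : 0 < D) (t : ℝ) {v : ℂ} (hv : ‖v‖ = 1) :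
    1 < ‖radialPt D t v‖ := by
  rw [norm_radialPt D t hv, Real.one_lt_exp_iff]
  have : (0 : ℝ) < D := by exact_mod_cast hD
  positivity

theorem radialPt_pow {D : ℕ} (hD : 0 < D) (t : ℝ) (v : ℂ) :
    radialPt D (t + 1) v ^ D = radialPt D t (v ^ D) := by
  have hD' : (0 : ℝ) < D := by exact_mod_cast hD
  rw [radialPt, radialPt, mul_pow, ← Complex.ofReal_pow, ← Real.exp_nat_mul]
  congr 3
  rw [neg_add, Real.rpow_add hD', Real.rpow_neg_one]
  field_simp

theorem continuous_radialPt {D : ℕ} (hD : 0 < D) :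
    Continuous fun q : ℝ × ℂ => radialPt D q.1 q.2 := by
  have hD' : (D : ℝ) ≠ 0 := by exact_mod_cast hD.ne'
  have : Continuous fun q : ℝ × ℂ => (D : ℝ) ^ (-q.1) :=
    continuous_const.rpow (by fun_prop) fun q => Or.inl hD'
  unfold radialPt
  fun_prop

/-- A point outside the closed unit disk in radial coordinates. -/
theorem radialPt_logb {D : ℕ} (hD : 2 ≤ D) {w : ℂ} (hw : 1 < ‖w‖) :
    radialPt D (-Real.logb D (Real.log ‖w‖)) (w / ‖w‖) = w := by
  have hD' : (1 : ℝ) < D := by exact_mod_cast (by omega : 1 < D)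
  have hlog : 0 < Real.log ‖w‖ := Real.log_pos hw
  rw [radialPt, neg_neg, Real.rpow_logb (by linarith) hD'.ne' hlog, Real.exp_log (by linarith)]
  have : (‖w‖ : ℂ) ≠ 0 := by exact_mod_cast (by linarith : ‖w‖ ≠ 0)
  field_simp

/-- A function of the radial coordinate whose increments over time steps of length one are
controlled by a repelling functional equation converges uniformly on the circle. -/
theorem exists_boundary_limit {D : ℕ} (hD : 2 ≤ D) {Psi Q : ℂ → ℂ}
    (hPsi : ContinuousOn Psi {w | 1 < ‖w‖}) (hQ : ∀ w, 1 < ‖w‖ → Psi (w ^ D) = Q (Psi w))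
    {η ρ : ℝ} (hη : 0 < η) (hρ : 1 < ρ)
    (hexp : ∀ w w', 1 < ‖w‖ → ‖w‖ < ρ → 1 < ‖w'‖ → ‖w'‖ < ρ → dist (Psi w) (Psi w') < η →
      3 / 2 * dist (Psi w) (Psi w') ≤ dist (Q (Psi w)) (Q (Psi w'))) :
    ∃ g : ℂ → ℂ, ContinuousOn g {v | ‖v‖ = 1} ∧ ∀ ε > 0, ∃ ρ' > 1, ∀ w : ℂ, 1 < ‖w‖ → ‖w‖ < ρ' →
      dist (Psi w) (g (w / ‖w‖)) < ε := by
  have hD0 : 0 < D := by omega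
  have hD' : (1 : ℝ) < D := by exact_mod_cast (by omega : 1 < D)
  -- In the coordinates `(t, v)` the map `w ↦ w ^ D` becomes `(t, v) ↦ (t - 1, v ^ D)`, and the
  -- circle lies at `t = ∞`.
  set Φ : ℝ → ℂ → ℂ := fun t v => Psi (radialPt D t v) with hΦ
  have hΦc : ContinuousOn (fun q : ℝ × ℂ => Φ q.1 q.2) (univ ×ˢ {v | ‖v‖ = 1}) :=
    hPsi.comp (continuous_radialPt hD0).continuousOn fun q hq => one_lt_norm_radialPt hD0 _ hq.2
  have hΦt : ∀ v, ‖v‖ = 1 → Continuous fun t => Φ t v := fun v hv =>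
    hΦc.comp_continuous (f := fun t => (t, v)) (by fun_prop) fun t => ⟨mem_univ _, hv⟩
  have hΦv : ∀ t, ContinuousOn (Φ t) {v | ‖v‖ = 1} := fun t =>
    hΦc.comp (f := fun v => (t, v)) (by fun_prop) fun v hv => ⟨mem_univ _, hv⟩
  have hcirc : ∀ {v : ℂ}, ‖v‖ = 1 → ‖v ^ D‖ = 1 := fun hv => by rw [norm_pow, hv, one_pow]
  have hΦQ : ∀ t v, ‖v‖ = 1 → Q (Φ (t + 1) v) = Φ t (v ^ D) := fun t v hv => by
    rw [hΦ]
    simp only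
    rw [← hQ _ (one_lt_norm_radialPt hD0 _ hv), radialPt_pow hD0]
  obtain ⟨t₀, ht₀⟩ : ∃ t₀ : ℝ, ∀ t ≥ t₀, ∀ v : ℂ, ‖v‖ = 1 → ‖radialPt D t v‖ < ρ := by
    refine ⟨-Real.logb D (Real.log ρ) + 1, fun t ht v hv => ?_⟩
    rw [norm_radialPt D t hv, ← Real.lt_log_iff_exp_lt (by linarith),
      ← Real.lt_logb_iff_rpow_lt hD' (Real.log_pos hρ)]
    linarith
  obtain ⟨k, hk, huc⟩ : ∃ k : ℕ, 0 < k ∧ ∀ t ∈ Icc t₀ (t₀ + 2), ∀ t' ∈ Icc t₀ (t₀ + 2),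
      |t - t'| ≤ 1 / k → ∀ v, ‖v‖ = 1 → dist (Φ t v) (Φ t' v) ≤ η / 2 := by
    have hcomp : IsCompact (Icc t₀ (t₀ + 2) ×ˢ {v : ℂ | ‖v‖ = 1}) :=
      isCompact_Icc.prod (by
        have : {v : ℂ | ‖v‖ = 1} = Metric.sphere 0 1 := by ext; simp
        rw [this]; exact isCompact_sphere 0 1)
    have hu := hcomp.uniformContinuousOn_of_continuous
      (hΦc.mono (prod_mono (subset_univ _) subset_rfl))
    obtain ⟨δ, hδ, h⟩ := Metric.uniformContinuousOn_iff.1 hu (η / 2) (by positivity)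
    obtain ⟨k, hk⟩ := exists_nat_gt (1 / δ)
    have hk0 : (0 : ℝ) < k := (by positivity : 0 < 1 / δ).trans hk
    refine ⟨k, by exact_mod_cast hk0, fun t ht t' ht' htt v hv => ?_⟩
    refine (h (t, v) ⟨ht, hv⟩ (t', v) ⟨ht', hv⟩ ?_).le
    rw [Prod.dist_eq, dist_self, Real.dist_eq]
    refine max_lt (htt.trans_lt ?_) hδ
    rwa [div_lt_comm₀ hk0 hδ]
  have hk0 : (0 : ℝ) < k := by exact_mod_cast hk
  -- Moving one unit outwards in `t` undoes one application of `Q`, so the expansion factor `3 / 2`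
  -- shrinks the oscillation by `2 / 3` per unit.
  have hosc : ∀ n : ℕ, ∀ t ∈ Icc (t₀ + n) (t₀ + n + 2), ∀ t' ∈ Icc (t₀ + n) (t₀ + n + 2),
      |t - t'| ≤ 1 / k → ∀ v, ‖v‖ = 1 → dist (Φ t v) (Φ t' v) ≤ (2 / 3) ^ n * (η / 2) := by
    intro n
    induction n with
    | zero => simpa using huc
    | succ n ih =>
      intro t ht t' ht' htt v hv
      push_cast at ht ht'
      have hsub : uIcc t t' ⊆ Icc (t₀ + (n + 1)) (t₀ + (n + 1) + 2) := uIcc_subset_Icc ht ht'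
      have hbase : t₀ ≤ t₀ + (n + 1) := by linarith [(by positivity : (0 : ℝ) ≤ n + 1)]
      have hstep : ∀ x ∈ uIcc t t', dist (Φ x v) (Φ t v) < η →
          dist (Φ x v) (Φ t v) ≤ (2 / 3) ^ (n + 1) * (η / 2) := by
        intro x hx hxη
        have hx' := hsub hx
        have h1 := hexp _ _ (one_lt_norm_radialPt hD0 x hv) (ht₀ x (hbase.trans hx'.1) v hv)
          (one_lt_norm_radialPt hD0 t hv) (ht₀ t (hbase.trans ht.1) v hv) hxη
        have e1 := hΦQ (x - 1) v hv
        have e2 := hΦQ (t - 1) v hv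
        rw [sub_add_cancel] at e1 e2
        have h2 := ih (x - 1) ⟨by linarith [hx'.1], by linarith [hx'.2]⟩ (t - 1)
          ⟨by linarith [ht.1], by linarith [ht.2]⟩ (by
            rw [sub_sub_sub_cancel_right]
            exact (abs_sub_left_of_mem_uIcc hx).trans (by rwa [abs_sub_comm])) (v ^ D) (hcirc hv)
        rw [← e1, ← e2] at h2
        rw [pow_succ]
        linarith
      have hpow : (2 / 3 : ℝ) ^ (n + 1) * (η / 2) ≤ η / 3 := by
        have : (2 / 3 : ℝ) ^ n ≤ 1 := pow_le_one₀ (by norm_num) (by norm_num)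
        rw [pow_succ]
        nlinarith
      rw [dist_comm]
      refine hstep t' right_mem_uIcc ?_
      by_contra! hcon
      -- The expansion estimate holds only for distances below `η`, where it yields at most `η / 3`.
      -- By continuity the distance cannot jump over `η / 2`, so it never leaves the admissible
      -- range.
      have hivt := intermediate_value_uIcc (a := t) (b := t')
        (f := fun x => dist (Φ x v) (Φ t v)) ((hΦt v hv).dist continuous_const).continuousOn
      obtain ⟨x, hx, hxe⟩ := hivt (show η / 2 ∈ _ by
        rw [mem_uIcc]; left; simp only [dist_self]; constructor <;> linarith)
      have := hstep x hx (by simp only at hxe; linarith)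
      simp only at hxe
      linarith
  set C : ℝ := k * (η / 2) with hC
  have hC0 : 0 < C := by positivity
  have hchain : ∀ n : ℕ, ∀ x ∈ Icc (0 : ℝ) 1, ∀ v, ‖v‖ = 1 →
      dist (Φ (t₀ + n) v) (Φ (t₀ + n + x) v) ≤ C * (2 / 3) ^ n := by
    intro n x hx v hv
    have h := dist_le_range_sum_of_dist_le (f := fun j : ℕ => Φ (t₀ + n + x * (j / k)) v)
      (d := fun _ => (2 / 3) ^ n * (η / 2)) k fun {j} hj => by
        have hjk : ((j : ℝ) + 1) / k ≤ 1 := by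
          rw [div_le_one hk0]; exact_mod_cast hj
        have hj0 : 0 ≤ (j : ℝ) / k := by positivity
        have hj1 : (j : ℝ) / k ≤ 1 := le_trans (by gcongr; linarith) hjk
        have hb : ∀ y ∈ Icc (0 : ℝ) 1, t₀ + n + x * y ∈ Icc (t₀ + n) (t₀ + n + 2) := fun y hy => by
          have h1 := mul_nonneg hx.1 hy.1
          have h2 := mul_le_one₀ hx.2 hy.1 hy.2
          exact ⟨by linarith, by linarith⟩
        refine hosc n _ (hb _ ⟨hj0, hj1⟩) _ ?_ ?_ v hv
        · push_cast
          exact hb _ ⟨by positivity, hjk⟩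
        · push_cast
          have : t₀ + n + x * (j / k) - (t₀ + n + x * ((j + 1) / k)) = -(x * (1 / k)) := by
            field_simp; ring
          rw [this, abs_neg, abs_of_nonneg (mul_nonneg hx.1 (by positivity))]
          exact mul_le_of_le_one_left (by positivity) hx.2
    simp only [Nat.cast_zero, zero_div, mul_zero, add_zero, div_self hk0.ne', mul_one,
      Finset.sum_const, Finset.card_range, nsmul_eq_mul] at h
    rw [hC]
    linarith
  have hgeo : ∀ v, ‖v‖ = 1 → ∀ n : ℕ, dist (Φ (t₀ + n) v) (Φ (t₀ + (n + 1 : ℕ)) v) ≤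
      C * (2 / 3) ^ n := fun v hv n => by
    have := hchain n 1 ⟨zero_le_one, le_rfl⟩ v hv
    push_cast
    rwa [← add_assoc]
  have hlim : ∀ v, ∃ y, ‖v‖ = 1 → Tendsto (fun n : ℕ => Φ (t₀ + n) v) atTop (𝓝 y) := fun v => by
    by_cases hv : ‖v‖ = 1
    · obtain ⟨y, hy⟩ := cauchySeq_tendsto_of_complete
        (cauchySeq_of_le_geometric (2 / 3) C (by norm_num) (hgeo v hv))
      exact ⟨y, fun _ => hy⟩
    · exact ⟨0, fun h => absurd h hv⟩
  choose g hg using hlim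
  have hgd : ∀ v, ‖v‖ = 1 → ∀ n : ℕ, dist (Φ (t₀ + n) v) (g v) ≤ 3 * C * (2 / 3) ^ n := fun v hv n => by
    have := dist_le_of_le_geometric_of_tendsto (2 / 3) C (by norm_num) (hgeo v hv) (hg v hv) n
    exact this.trans_eq (by ring)
  have hzero : Tendsto (fun n : ℕ => 4 * C * (2 / 3 : ℝ) ^ n) atTop (𝓝 0) := by
    simpa using (tendsto_pow_atTop_nhds_zero_of_lt_one (by norm_num : (0 : ℝ) ≤ 2 / 3)
      (by norm_num)).const_mul (4 * C)
  refine ⟨g, ?_, fun ε hε => ?_⟩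
  · refine TendstoUniformlyOn.continuousOn (F := fun (n : ℕ) v => Φ (t₀ + n) v) (p := atTop) ?_
      (Frequently.of_forall fun n => hΦv _)
    rw [Metric.tendstoUniformlyOn_iff]
    intro ε hε
    filter_upwards [hzero.eventually_lt_const hε] with n hn v hv
    rw [dist_comm]
    have := hgd v hv n
    have : 0 ≤ C * (2 / 3 : ℝ) ^ n := by positivity
    linarith
  · obtain ⟨n, hn⟩ := (hzero.eventually_lt_const hε).exists
    have hgd' : ∀ t ≥ t₀ + n, ∀ v, ‖v‖ = 1 → dist (Φ t v) (g v) < ε := by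
      intro t ht v hv
      obtain ⟨m, hm⟩ : ∃ m : ℕ, m = ⌊t - t₀⌋₊ := ⟨_, rfl⟩
      have htn : (0 : ℝ) ≤ t - t₀ := by linarith [(by positivity : (0 : ℝ) ≤ n)]
      have h1 : (m : ℝ) ≤ t - t₀ := hm ▸ Nat.floor_le htn
      have h2 : t - t₀ < m + 1 := hm ▸ Nat.lt_floor_add_one _
      have h3 : n ≤ m := hm ▸ Nat.le_floor (by linarith)
      have h4 := hchain m (t - t₀ - m) ⟨by linarith, by linarith⟩ v hv
      rw [show t₀ + m + (t - t₀ - m) = t by ring, dist_comm] at h4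
      have h5 := hgd v hv m
      have h6 := dist_triangle (Φ t v) (Φ (t₀ + m) v) (g v)
      have h7 : (2 / 3 : ℝ) ^ m ≤ (2 / 3) ^ n := pow_le_pow_of_le_one (by norm_num) (by norm_num) h3
      nlinarith
    refine ⟨Real.exp ((D : ℝ) ^ (-(t₀ + n))), ?_, fun w hw hwρ => ?_⟩
    · rw [gt_iff_lt, Real.one_lt_exp_iff]; positivity
    · have hw0 : ‖w‖ ≠ 0 := by linarith
      have hv : ‖w / ‖w‖‖ = 1 := by rw [norm_div, Complex.norm_real, norm_norm, div_self hw0]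
      have := hgd' (-Real.logb D (Real.log ‖w‖)) (by
        rw [← Real.log_lt_iff_lt_exp (by linarith)] at hwρ
        have := (Real.logb_lt_iff_lt_rpow hD' (Real.log_pos hw)).2 hwρ
        linarith) _ hv
      simpa only [hΦ, radialPt_logb hD hw] using this

theorem exists_isBoettcherParam {d : ℕ} (hd : 2 ≤ d) {A : Fin (d - 1) → ℂ}
    (hA : A ∈ paramSpace d) : ∃ Psi, IsBoettcherParam d (centredPoly d A) Psi := by
  have hA1 : ∀ r, ‖A r‖ ≤ 1 := fun r => (norm_lt_one_of_mem_paramSpace hA r).le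
  obtain ⟨C, hC, lam, hlam, hyp⟩ := hA.2.1
  obtain ⟨N, hN2, hN⟩ := ((((tendsto_pow_atTop_atTop_of_one_lt hlam).const_mul_atTop
    hC).eventually_ge_atTop 2).and (eventually_ge_atTop 1)).exists
  set P := centredPoly d A with hP
  obtain ⟨η, hη, hexp⟩ := (isCompact_juliaSet hd hA1).exists_expanding_radius (Q := polyIter P N)
    fun y hy => ⟨_, hasStrictDerivAt_polyIter' P N y, hN2.trans (hyp y hy N hN)⟩
  obtain ⟨Psi, hPsi⟩ := IsBoettcherOn.exists_forall_one_lt hd hA.2.2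
  obtain ⟨ρ, hρ, hnear⟩ := exists_radius_near_juliaSet hd hA1 hPsi (half_pos hη)
  have hcont : ContinuousOn Psi {w | 1 < ‖w‖} := fun w hw => by
    obtain ⟨r, hr1, hr2⟩ := exists_between (show 1 < ‖w‖ from hw)
    exact ((hPsi r hr1).continuousOn.continuousAt (mem_of_superset
      ((isOpen_lt continuous_const continuous_norm).mem_nhds hr2)
      fun v (hv : r < ‖v‖) => hv.le)).continuousWithinAt
  -- A single step of `P` need not expand; the limit is therefore taken for the iterate of order
  -- `N`, conjugate to `w ↦ w ^ d ^ N`.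
  have hDN : 2 ≤ d ^ N := hd.trans (Nat.le_self_pow (by omega) d)
  obtain ⟨g, hg, hlim⟩ := exists_boundary_limit hDN (Q := polyIter P N) hcont
    (fun w hw => conj_iterate (by omega) (le_of_lt hw) (hPsi _ hw).conj N le_rfl)
    (half_pos hη) hρ fun w w' hw hwρ hw' hwρ' hdist => by
      obtain ⟨y, hy, hyd⟩ := hnear w hw hwρ
      refine hexp y hy _ _ (by linarith) ?_
      have := dist_triangle (Psi w') (Psi w) y
      rw [dist_comm] at hdist
      linarith
  classical
  let F : ℂ → ℂ := fun w => if 1 < ‖w‖ then Psi w else g w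
  have hF1 : ∀ w, 1 < ‖w‖ → F w = Psi w := fun w hw => if_pos hw
  have hF2 : ∀ w, ‖w‖ = 1 → F w = g w := fun w hw => if_neg (by rw [hw]; exact lt_irrefl 1)
  have hFc : ContinuousOn F {w | 1 ≤ ‖w‖} := by
    intro w₀ (hw₀ : 1 ≤ ‖w₀‖)
    rcases hw₀.lt_or_eq with h1 | h1
    · have hopen : {w : ℂ | 1 < ‖w‖} ∈ 𝓝 w₀ :=
        (isOpen_lt continuous_const continuous_norm).mem_nhds h1
      exact ((hcont.continuousAt hopen).congr (by
        filter_upwards [hopen] with w hw using (hF1 w hw).symm)).continuousWithinAt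
    · have hw00 : w₀ ≠ 0 := norm_pos_iff.1 (by linarith)
      have hproj : ContinuousAt (fun w : ℂ => w / ‖w‖) w₀ := by
        refine continuousAt_id.div (by fun_prop) ?_
        rw [← h1]; simp
      have hproj0 : w₀ / ‖w₀‖ = w₀ := by rw [← h1]; simp
      have hg' : Tendsto (fun w : ℂ => g (w / ‖w‖)) (𝓝[{w | 1 ≤ ‖w‖}] w₀) (𝓝 (g w₀)) := by
        refine (hg w₀ h1.symm).tendsto.comp (tendsto_nhdsWithin_iff.2 ⟨?_, ?_⟩)
        · have := hproj.tendsto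
          rw [hproj0] at this
          exact this.mono_left nhdsWithin_le_nhds
        · filter_upwards [self_mem_nhdsWithin] with w (hw : 1 ≤ ‖w‖)
          have : ‖w‖ ≠ 0 := by linarith
          simp only [norm_div, Complex.norm_real, norm_norm, div_self this]
      rw [ContinuousWithinAt, hF2 w₀ h1.symm]
      refine tendsto_of_tendsto_of_dist hg' (Metric.tendsto_nhds.2 fun ε hε => ?_)
      obtain ⟨ρ', hρ', hlim'⟩ := hlim ε hε
      have hlt : ∀ᶠ w in 𝓝[{w : ℂ | 1 ≤ ‖w‖}] w₀, ‖w‖ < ρ' :=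
        (continuous_norm.continuousAt.eventually_lt_const
          (show ‖w₀‖ < ρ' by rw [← h1]; exact hρ')).filter_mono
          nhdsWithin_le_nhds
      filter_upwards [hlt, self_mem_nhdsWithin] with w hwρ (hw : 1 ≤ ‖w‖)
      rw [Real.dist_eq, sub_zero, abs_of_nonneg dist_nonneg, dist_comm]
      rcases hw.lt_or_eq with h2 | h2
      · rw [hF1 w h2]; exact hlim' w h2 hwρ
      · rw [hF2 w h2.symm, ← h2]; simpa using hε
  refine ⟨F, hFc, ?_, ?_⟩
  · have hmaps : MapsTo (fun w : ℂ => w ^ d) {w | 1 ≤ ‖w‖} {w | 1 ≤ ‖w‖} :=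
      fun w hw => le_norm_pow le_rfl (by omega) hw
    refine EqOn.of_subset_closure (s := {w : ℂ | 1 < ‖w‖}) (f := fun w => F (w ^ d))
      (g := fun w => P.eval (F w)) (fun w hw => ?_) (hFc.comp (by fun_prop) hmaps)
      (P.continuous.comp_continuousOn hFc) (fun w (hw : 1 < ‖w‖) => hw.le)
      subset_closure_one_lt_norm
    have hw' : 1 < ‖w ^ d‖ := by rw [norm_pow]; exact one_lt_pow₀ hw (by omega)
    simp only [hF1 w hw, hF1 _ hw', (hPsi _ hw).conj w le_rfl, hP]
  · refine (hPsi 2 one_lt_two).tangent.congr' ?_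
    filter_upwards [tendsto_norm_cobounded_atTop.eventually_gt_atTop 1] with w hw
    rw [hF1 w hw]

/-! ### Holomorphic dependence of the Böttcher parametrization on the coefficients. -/

/-- The operator `v ↦ m v - v ∘ σ` is invertible if the products of `m` along the orbits of `σ`
grow uniformly exponentially. -/
theorem isInvertible_smul_sub_compContinuous {X : Type*} [TopologicalSpace X] (σ : C(X, X))
    (m : X →ᵇ ℂ) {C κ : ℝ} (hC : 0 < C) (hκ : 1 < κ)
    (h : ∀ x n, C * κ ^ n ≤ ∏ k ∈ Finset.range n, ‖m (σ^[k] x)‖) :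
    (m • ContinuousLinearMap.id ℂ (X →ᵇ ℂ) -
      BoundedContinuousFunction.compContinuousCLM ℂ ℂ σ).IsInvertible := by
  have hm : ∀ x, C * κ ≤ ‖m x‖ := fun x => by simpa using h x 1
  have hm0 : ∀ x, m x ≠ 0 := fun x => norm_pos_iff.1 (lt_of_lt_of_le (by positivity) (hm x))
  let mi : X →ᵇ ℂ := BoundedContinuousFunction.ofNormedAddCommGroup (fun x => (m x)⁻¹)
    (m.continuous.inv₀ hm0) (C * κ)⁻¹ fun x => by
      rw [norm_inv]
      exact inv_anti₀ (by positivity) (hm x)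
  have hmi : ∀ x, mi x = (m x)⁻¹ := fun x => rfl
  let T : (X →ᵇ ℂ) →L[ℂ] (X →ᵇ ℂ) :=
    mi • BoundedContinuousFunction.compContinuousCLM ℂ ℂ σ
  have hT : ∀ v x, T v x = (m x)⁻¹ * v (σ x) := fun v x => rfl
  have hTn : ∀ n : ℕ, ∀ v x,
      (T ^ n) v x = (∏ k ∈ Finset.range n, m (σ^[k] x))⁻¹ * v (σ^[n] x) := by
    intro n
    induction n with
    | zero => simp
    | succ n ih =>
      intro v x
      rw [pow_succ', mul_apply_eq_comp, hT, ih, Finset.prod_range_succ']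
      simp only [Function.iterate_succ_apply, Function.iterate_zero_apply, mul_inv]
      ring
  have hlim : Tendsto (fun n : ℕ => C * κ ^ n) atTop atTop :=
    (tendsto_pow_atTop_atTop_of_one_lt hκ).const_mul_atTop hC
  obtain ⟨n, hn⟩ := (hlim.eventually_ge_atTop 2).exists
  have hnorm : ‖T ^ n‖ < 1 := by
    refine lt_of_le_of_lt (ContinuousLinearMap.opNorm_le_bound _ (by norm_num : (0 : ℝ) ≤ 1 / 2)
      fun v => ?_) (by norm_num)
    refine (BoundedContinuousFunction.norm_le (by positivity)).2 fun x => ?_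
    rw [hTn, norm_mul, norm_inv, norm_prod]
    gcongr
    · rw [one_div]
      exact inv_anti₀ (by norm_num) (hn.trans (h x n))
    · exact v.norm_coe_le_norm _
  -- The operator factors as multiplication by `m` followed after `1 - T`. Only a power of `T` need
  -- be a contraction, and `1 - T` is a commuting factor of `1 - T ^ n`.
  have hu1 : IsUnit (1 - T ^ n) := 
    isUnit_one_sub_of_norm_lt_one (R := (X →ᵇ ℂ) →L[ℂ] (X →ᵇ ℂ)) hnorm
  have hu2 : IsUnit (1 - T) := by
    have e1 := mul_neg_geom_sum T n
    have e2 := geom_sum_mul_neg T n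
    have hc : Commute (1 - T) (∑ i ∈ Finset.range n, T ^ i) := e1.trans e2.symm
    rw [← e1] at hu1
    exact (hc.isUnit_mul_iff.1 hu1).1
  obtain ⟨U, hU⟩ := hu2
  let M : (X →ᵇ ℂ) →L[ℂ] (X →ᵇ ℂ) := m • ContinuousLinearMap.id ℂ (X →ᵇ ℂ)
  let Mi : (X →ᵇ ℂ) →L[ℂ] (X →ᵇ ℂ) := mi • ContinuousLinearMap.id ℂ (X →ᵇ ℂ)
  have hM : M.IsInvertible := by
    refine ContinuousLinearMap.IsInvertible.of_inverse (g := Mi) ?_ ?_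
    · ext v x
      change m x * (mi x * v x) = v x
      rw [hmi, mul_inv_cancel_left₀ (hm0 x)]
    · ext v x
      change mi x * (m x * v x) = v x
      rw [hmi, inv_mul_cancel_left₀ (hm0 x)]
  have hUi : (1 - T).IsInvertible := ⟨ContinuousLinearEquiv.ofUnit U, by rw [← hU]; rfl⟩
  have hcomp := hM.comp hUi
  convert hcomp using 1
  ext v x
  change m x * v x - v (σ x) = m x * (v x - mi x * v (σ x))
  rw [hmi, mul_sub, mul_inv_cancel_left₀ (hm0 x)]

namespace IsBoettcherParam

variable {d : ℕ} (hd : 2 ≤ d) {A : Fin (d - 1) → ℂ} (hA : A ∈ paramSpace d) {Psi : ℂ → ℂ}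
  (hPsi : IsBoettcherParam d (centredPoly d A) Psi)
include hd hPsi

theorem mem_basinInfinity {w : ℂ} (hw : 1 < ‖w‖) : Psi w ∈ basinInfinity (centredPoly d A) :=
  ((isBoettcherOn_one_iff.2 hPsi).mono hw.le).mem_basinInfinity hd hw le_rfl

include hA

/-- The circle is invariant and compact, so the orbit of `Psi w` is bounded; and `Psi w` is a limit
of points `Psi v` with `1 < ‖v‖`, which escape. -/
theorem mem_juliaSet {w : ℂ} (hw : ‖w‖ = 1) : Psi w ∈ juliaSet (centredPoly d A) := by
  have hA1 : ∀ r, ‖A r‖ ≤ 1 := fun r => (norm_lt_one_of_mem_paramSpace hA r).le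
  rw [juliaSet, frontier_eq_closure_inter_closure]
  constructor
  · refine subset_closure ?_
    have hsub : Metric.sphere (0 : ℂ) 1 ⊆ {w | 1 ≤ ‖w‖} := fun w hw => by
      simp only [mem_sphere_iff_norm, sub_zero] at hw
      exact hw.ge
    obtain ⟨M, hM⟩ := (isCompact_sphere (0 : ℂ) 1).exists_bound_of_continuousOn
      (hPsi.continuousOn.mono hsub)
    refine mem_filledJulia_of_isBounded (M := M) one_pos fun n => ?_
    rw [one_mul, ← conj_iterate (by omega) le_rfl hPsi.conj n hw.ge]
    exact hM _ (by simp [hw])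
  · have hcl := subset_closure_one_lt_norm (a := w) hw.ge
    have hc : ContinuousWithinAt Psi {w | 1 < ‖w‖} w :=
      (hPsi.continuousOn w hw.ge).mono fun w (hw : 1 < ‖w‖) => hw.le
    have hmem := hc.mem_closure_image hcl
    refine closure_mono ?_ hmem
    rintro _ ⟨v, hv, rfl⟩
    rw [filledJulia, compl_compl]
    exact hPsi.mem_basinInfinity hd hv

theorem derivative_eval_ne_zero {w : ℂ} (hw : 1 ≤ ‖w‖) :
    (centredPoly d A).derivative.eval (Psi w) ≠ 0 := by
  rcases hw.lt_or_eq with h | h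
  · exact derivative_eval_ne_zero_of_mem_basinInfinity hA.2.2 (hPsi.mem_basinInfinity hd h)
  · exact derivative_eval_ne_zero_of_mem_juliaSet hA.2.1 (hPsi.mem_juliaSet hd hA h.symm)

end IsBoettcherParam

theorem OutsideDisk.iterate_powMap {R : ℝ} (hR : 1 ≤ R) {d : ℕ} (hd : d ≠ 0) (k : ℕ)
    (w : OutsideDisk R) : (((OutsideDisk.powMap hR hd)^[k] w : OutsideDisk R) : ℂ) = w ^ d ^ k := by
  induction k with
  | zero => simp
  | succ k ih =>
    rw [Function.iterate_succ_apply', pow_succ, pow_mul, ← ih]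
    rfl

/-- An orbit off the circle enters the region `R ≤ ‖w‖` and stays there, where factors of at least
`3 / 2` make up for any initial loss. Compactness of the annulus bounds the waiting time uniformly.
-/
theorem OutsideDisk.exists_uniform_growth {d : ℕ} (hd : 2 ≤ d) (m : C(OutsideDisk 1, ℂ))
    (hm0 : ∀ w, m w ≠ 0) {R : ℝ} (hR : ∀ w : OutsideDisk 1, R ≤ ‖(w : ℂ)‖ → 3 / 2 ≤ ‖m w‖)
    (hcirc : ∀ w : OutsideDisk 1, ‖(w : ℂ)‖ = 1 → ∃ n ≥ 1,
      3 / 2 < ∏ k ∈ Finset.range n, ‖m ((OutsideDisk.powMap le_rfl (by omega : d ≠ 0))^[k] w)‖) :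
    ∃ C : ℝ, 0 < C ∧ ∃ κ : ℝ, 1 < κ ∧ ∀ w n, C * κ ^ n ≤
      ∏ k ∈ Finset.range n, ‖m ((OutsideDisk.powMap le_rfl (by omega : d ≠ 0))^[k] w)‖ := by
  have hd0 : d ≠ 0 := by omega
  set σ := OutsideDisk.powMap le_rfl hd0 with hσ
  have hS : IsCompact {w : OutsideDisk 1 | ‖(w : ℂ)‖ ≤ R} := by
    have hcl : IsClosed {w : ℂ | 1 ≤ ‖w‖} := isClosed_le continuous_const continuous_norm
    have := hcl.isClosedEmbedding_subtypeVal.isCompact_preimage (isCompact_closedBall (0 : ℂ) R)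
    have e : {w : OutsideDisk 1 | ‖(w : ℂ)‖ ≤ R} = Subtype.val ⁻¹' Metric.closedBall (0 : ℂ) R := by
      ext w; simp
    rw [e]
    exact this
  have hex : ∀ w : OutsideDisk 1, ∃ n ≥ 1, 3 / 2 < ∏ k ∈ Finset.range n, ‖m (σ^[k] w)‖ := by
    intro w
    rcases w.2.lt_or_eq with h | h
    · obtain ⟨k₀, hk₀⟩ := eventually_atTop.1
        ((tendsto_norm_pow_pow hd h).eventually_ge_atTop R)
      have hpos : 0 < ∏ k ∈ Finset.range k₀, ‖m (σ^[k] w)‖ :=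
        Finset.prod_pos fun k _ => norm_pos_iff.2 (hm0 _)
      have hlim := (tendsto_pow_atTop_atTop_of_one_lt
        (by norm_num : (1 : ℝ) < 3 / 2)).const_mul_atTop hpos
      obtain ⟨n, hn, hn1⟩ := ((hlim.eventually_gt_atTop (3 / 2)).and (eventually_ge_atTop 1)).exists
      refine ⟨k₀ + n, by omega, hn.trans_le ?_⟩
      rw [Finset.prod_range_add]
      gcongr
      rw [← Finset.card_range n, ← Finset.prod_const, Finset.card_range]
      refine Finset.prod_le_prod (fun _ _ => by norm_num) fun k _ => hR _ ?_
      rw [OutsideDisk.iterate_powMap, norm_pow]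
      exact hk₀ _ (by omega)
    · exact hcirc w h.symm
  obtain ⟨c, hc, hcm⟩ : ∃ c > 0, ∀ w, c ≤ ‖m w‖ := by
    obtain ⟨c, hc, hcm⟩ := hS.exists_forall_le' (f := fun w => ‖m w‖) (a := 0)
      m.continuous.norm.continuousOn fun w _ => norm_pos_iff.2 (hm0 w)
    refine ⟨min c (3 / 2), by positivity, fun w => ?_⟩
    rcases le_total ‖(w : ℂ)‖ R with h | h
    · exact (min_le_left _ _).trans (hcm w h)
    · exact (min_le_right _ _).trans (hR w h)
  have hprodc : ∀ n, Continuous fun w => ∏ k ∈ Finset.range n, ‖m (σ^[k] w)‖ := fun n =>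
    continuous_finsetProd _ fun k _ => (m.continuous.comp (σ.continuous.iterate k)).norm
  obtain ⟨N, hN⟩ := hS.elim_directed_cover
    (fun N : ℕ => {w | ∃ n ≥ 1, n ≤ N ∧ 3 / 2 < ∏ k ∈ Finset.range n, ‖m (σ^[k] w)‖})
    (fun N => by
      have : {w | ∃ n ≥ 1, n ≤ N ∧ 3 / 2 < ∏ k ∈ Finset.range n, ‖m (σ^[k] w)‖} =
          ⋃ n, ⋃ (_ : 1 ≤ n ∧ n ≤ N), {w | 3 / 2 < ∏ k ∈ Finset.range n, ‖m (σ^[k] w)‖} := by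
        ext w; simp [and_assoc]
      rw [this]
      exact isOpen_iUnion fun n => isOpen_iUnion fun _ => isOpen_lt continuous_const (hprodc n))
    (fun w _ => by
      obtain ⟨n, h1, h2⟩ := hex w
      exact mem_iUnion.2 ⟨n, n, h1, le_rfl, h2⟩)
    (directed_of_isDirected_le fun a b hab w ⟨n, h1, h2, h3⟩ => ⟨n, h1, h2.trans hab, h3⟩)
  refine _root_.exists_uniform_growth σ (fun w => ‖m w‖) hc hcm (max N 1) fun w => ?_
  rcases le_total ‖(w : ℂ)‖ R with h | h
  · obtain ⟨n, h1, h2, h3⟩ := hN h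
    exact ⟨n, h1, h2.trans (le_max_left _ _), h3.le⟩
  · exact ⟨1, le_rfl, le_max_right _ _, by simpa using hR w h⟩

theorem centredPoly_eval_mul_scaledCoeff (d : ℕ) (A : Fin (d - 1) → ℂ) {w : ℂ} (hw : w ≠ 0) (x : ℂ) :
    (centredPoly d A).eval (w * x) = w ^ d * (x ^ d + ∑ r, scaledCoeff d A w r * x ^ (r : ℕ)) := by
  have h := centredPoly_eval_mul d A hw (x - 1)
  rw [add_sub_cancel] at h
  rw [h, boettcherRemainder, add_sub_cancel]
  ring

theorem centredPoly_derivative_eval_mul_scaledCoeff {d : ℕ} (A : Fin (d - 1) → ℂ) {w : ℂ}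
    (hw : w ≠ 0) (x : ℂ) :
    (centredPoly d A).derivative.eval (w * x) = w ^ (d - 1) *
      (d * x ^ (d - 1) + ∑ r : Fin (d - 1), scaledCoeff d A w r * ((r : ℕ) * x ^ ((r : ℕ) - 1))) := by
  rw [centredPoly_derivative_eval, mul_add, Finset.mul_sum, mul_pow]
  congr 1
  · ring
  · refine Finset.sum_congr rfl fun r _ => ?_
    rcases Nat.eq_zero_or_pos (r : ℕ) with h0 | hpos
    · simp [h0]
    · have h1 : w ^ (d - 1) = w ^ ((r : ℕ) - 1) * w ^ (d - (r : ℕ)) := by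
        rw [← pow_add]; congr 1; omega
      have h2 : w ^ (d - (r : ℕ)) * w⁻¹ ^ (d - (r : ℕ)) = 1 := by
        rw [← mul_pow, mul_inv_cancel₀ hw, one_pow]
      rw [scaledCoeff, h1, mul_pow]
      linear_combination -(A r * (r : ℕ) * x ^ ((r : ℕ) - 1) * w ^ ((r : ℕ) - 1)) * h2

/-- The functional equation of the Böttcher parametrization `w ↦ w v(w)`, divided by `w ^ d`. -/
noncomputable def boettcherFun (d : ℕ) (hd : d ≠ 0)
    (q : (Fin (d - 1) → ℂ) × (OutsideDisk 1 →ᵇ ℂ)) : OutsideDisk 1 →ᵇ ℂ :=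
  q.2 ^ d + ∑ r : Fin (d - 1), q.1 r • (OutsideDisk.invPow le_rfl (d - (r : ℕ)) * q.2 ^ (r : ℕ)) -
    BoundedContinuousFunction.compContinuousCLM ℂ ℂ (OutsideDisk.powMap le_rfl hd) q.2

/-- The derivative of `P` along `w ↦ w a(w)`, divided by `w ^ (d - 1)`. -/
noncomputable def boettcherMultiplier (d : ℕ) (A : Fin (d - 1) → ℂ) (a : OutsideDisk 1 →ᵇ ℂ) :
    OutsideDisk 1 →ᵇ ℂ :=
  (d : ℂ) • a ^ (d - 1) + ∑ r : Fin (d - 1),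
    A r • (OutsideDisk.invPow le_rfl (d - (r : ℕ)) * (((r : ℕ) : ℂ) • a ^ ((r : ℕ) - 1)))

theorem boettcherFun_apply {d : ℕ} (hd : d ≠ 0) (B : Fin (d - 1) → ℂ) (v : OutsideDisk 1 →ᵇ ℂ)
    (w : OutsideDisk 1) : boettcherFun d hd (B, v) w =
      v w ^ d + ∑ r, scaledCoeff d B w r * v w ^ (r : ℕ) - v (OutsideDisk.powMap le_rfl hd w) := by
  simp [boettcherFun, scaledCoeff, OutsideDisk.invPow, mul_assoc]

theorem boettcherMultiplier_apply {d : ℕ} (A : Fin (d - 1) → ℂ) (a : OutsideDisk 1 →ᵇ ℂ)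
    (w : OutsideDisk 1) : boettcherMultiplier d A a w = d * a w ^ (d - 1) +
      ∑ r : Fin (d - 1), scaledCoeff d A w r * ((r : ℕ) * a w ^ ((r : ℕ) - 1)) := by
  simp only [boettcherMultiplier, BoundedContinuousFunction.coe_add, Pi.add_apply,
    BoundedContinuousFunction.coe_smul, BoundedContinuousFunction.coe_sum, Finset.sum_apply,
    BoundedContinuousFunction.coe_mul, Pi.mul_apply, BoundedContinuousFunction.coe_pow, Pi.pow_apply,
    smul_eq_mul, scaledCoeff, mul_assoc]
  rfl

theorem contDiff_boettcherFun {d : ℕ} (hd : d ≠ 0) {n : WithTop ℕ∞} :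
    ContDiff ℂ n (boettcherFun d hd) := by
  unfold boettcherFun
  have h2 : ContDiff ℂ n fun q : (Fin (d - 1) → ℂ) × (OutsideDisk 1 →ᵇ ℂ) => q.2 := contDiff_snd
  refine ((h2.pow d).add (ContDiff.sum fun r _ => ?_)).sub
    ((ContinuousLinearMap.contDiff _).comp h2)
  exact ((contDiff_apply ℂ ℂ r).comp contDiff_fst).smul (contDiff_const.mul (h2.pow _))

theorem hasFDerivAt_boettcherFun_right {d : ℕ} (hd : d ≠ 0) (A : Fin (d - 1) → ℂ)
    (a : OutsideDisk 1 →ᵇ ℂ) :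
    HasFDerivAt (fun v => boettcherFun d hd (A, v))
      (boettcherMultiplier d A a • ContinuousLinearMap.id ℂ (OutsideDisk 1 →ᵇ ℂ) -
        BoundedContinuousFunction.compContinuousCLM ℂ ℂ (OutsideDisk.powMap le_rfl hd)) a := by
  unfold boettcherFun
  have h := ((hasFDerivAt_pow (𝕜 := ℂ) d (x := a)).add (HasFDerivAt.fun_sum (u := Finset.univ)
    fun (r : Fin (d - 1)) _ => (((hasFDerivAt_pow (𝕜 := ℂ) (r : ℕ) (x := a)).const_mul
      (OutsideDisk.invPow le_rfl (d - (r : ℕ)))).const_smul (A r)))).sub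
    (BoundedContinuousFunction.compContinuousCLM ℂ ℂ
      (OutsideDisk.powMap le_rfl hd)).hasFDerivAt
  refine h.congr_fderiv ?_
  ext v w
  simp only [boettcherMultiplier]
  simp [add_mul, Finset.sum_mul, mul_assoc]
  exact Finset.sum_congr rfl fun r _ => by ring

theorem isInvertible_fderiv_boettcherFun {d : ℕ} (hd : d ≠ 0) (A : Fin (d - 1) → ℂ)
    (a : OutsideDisk 1 →ᵇ ℂ) {C κ : ℝ} (hC : 0 < C) (hκ : 1 < κ)
    (h : ∀ w n, C * κ ^ n ≤
      ∏ k ∈ Finset.range n, ‖boettcherMultiplier d A a ((OutsideDisk.powMap le_rfl hd)^[k] w)‖) :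
    (fderiv ℂ (boettcherFun d hd) (A, a) ∘L .inr ℂ _ _).IsInvertible := by
  have h1 : HasFDerivAt (fun v => boettcherFun d hd (A, v))
      (fderiv ℂ (boettcherFun d hd) (A, a) ∘L .inr ℂ _ _) a :=
    HasFDerivAt.comp (g := boettcherFun d hd) a
      ((contDiff_boettcherFun hd (n := 1)).differentiable one_ne_zero _).hasFDerivAt
      (hasFDerivAt_prodMk_right A a)
  rw [h1.unique (hasFDerivAt_boettcherFun_right hd A a)]
  exact isInvertible_smul_sub_compContinuous _ _ hC hκ h

namespace IsBoettcherParam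

theorem exists_quotient {d : ℕ} {P : Polynomial ℂ} {Psi : ℂ → ℂ} (h : IsBoettcherParam d P Psi) :
    ∃ a : OutsideDisk 1 →ᵇ ℂ, ∀ w, a w = Psi w / w := by
  obtain ⟨R, hR⟩ := eventually_cobounded_iff_norm.1
    (h.tangent.norm.eventually_le_const (u := 2) (by norm_num))
  have hc : ContinuousOn (fun w => Psi w / w) {w | 1 ≤ ‖w‖} :=
    h.continuousOn.div continuousOn_id fun w hw => OutsideDisk.ne_zero le_rfl ⟨w, hw⟩
  obtain ⟨M, hM⟩ := ((isCompact_closedBall (0 : ℂ) R).inter_right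
    (isClosed_le continuous_const continuous_norm)).exists_bound_of_continuousOn
    (hc.mono inter_subset_right)
  refine ⟨BoundedContinuousFunction.ofNormedAddCommGroup (fun w => Psi w / w)
    (continuousOn_iff_continuous_domRestrict.1 hc) (max 2 M) fun w => ?_, fun w => rfl⟩
  rcases le_total ‖(w : ℂ)‖ R with h1 | h1
  · exact (hM w ⟨by simpa using h1, w.2⟩).trans (le_max_right _ _)
  · exact (hR w h1).trans (le_max_left _ _)

/-- Since `P'(Psi w) = w ^ (d - 1) * m w`, the multiplier has the modulus of `P'(Psi w)` on the
circle, where hyperbolicity applies. It tends to `d ≥ 2` at infinity and has no zeros, as there are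
no critical points in the basin or on the Julia set. -/
theorem exists_multiplier_growth {d : ℕ} (hd : 2 ≤ d) {A : Fin (d - 1) → ℂ} (hA : A ∈ paramSpace d)
    {Psi : ℂ → ℂ} (h : IsBoettcherParam d (centredPoly d A) Psi) {a : OutsideDisk 1 →ᵇ ℂ}
    (ha : ∀ w, a w = Psi w / w) :
    ∃ C : ℝ, 0 < C ∧ ∃ κ : ℝ, 1 < κ ∧ ∀ w n, C * κ ^ n ≤ ∏ k ∈ Finset.range n,
      ‖boettcherMultiplier d A a
        ((OutsideDisk.powMap le_rfl (by omega : d ≠ 0))^[k] w)‖ := by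
  have hw0 : ∀ w : OutsideDisk 1, (w : ℂ) ≠ 0 := OutsideDisk.ne_zero le_rfl
  have hm : ∀ w : OutsideDisk 1, (centredPoly d A).derivative.eval (Psi w) =
      (w : ℂ) ^ (d - 1) * boettcherMultiplier d A a w := fun w => by
    rw [boettcherMultiplier_apply, ← centredPoly_derivative_eval_mul_scaledCoeff A (hw0 w), ha,
      mul_div_cancel₀ _ (hw0 w)]
  have hlim : Tendsto (fun w => (d : ℂ) * (Psi w / w) ^ (d - 1) + ∑ r : Fin (d - 1),
      scaledCoeff d A w r * ((r : ℕ) * (Psi w / w) ^ ((r : ℕ) - 1))) (Bornology.cobounded ℂ)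
      (𝓝 d) := by
    have h1 : Tendsto (fun w => (d : ℂ) * (Psi w / w) ^ (d - 1)) (Bornology.cobounded ℂ)
        (𝓝 (d * 1 ^ (d - 1))) := (h.tangent.pow _).const_mul _
    have h2 : Tendsto (fun w => ∑ r : Fin (d - 1),
        scaledCoeff d A w r * ((r : ℕ) * (Psi w / w) ^ ((r : ℕ) - 1))) (Bornology.cobounded ℂ)
        (𝓝 (∑ r : Fin (d - 1), 0 * ((r : ℕ) * 1 ^ ((r : ℕ) - 1)))) :=
      tendsto_finsetSum _ fun r _ => (tendsto_pi_nhds.1 (tendsto_scaledCoeff A) r).mul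
        ((h.tangent.pow _).const_mul _)
    simpa using h1.add h2
  have hd' : (2 : ℝ) ≤ d := by exact_mod_cast hd
  obtain ⟨R, hR⟩ := eventually_cobounded_iff_norm.1
    (hlim.norm.eventually_const_le (u := 3 / 2) (by rw [Complex.norm_natCast]; linarith))
  refine OutsideDisk.exists_uniform_growth hd (boettcherMultiplier d A a).toContinuousMap (R := R)
    (fun w h0 => ?_) (fun w hw => ?_) fun w hw => ?_
  · refine h.derivative_eval_ne_zero hd hA w.2 ?_
    rw [hm]
    exact mul_eq_zero_of_right _ h0
  · have := hR w hw
    rw [← ha, ← boettcherMultiplier_apply] at this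
    exact this
  · obtain ⟨C, hC, lam, hlam, hyp⟩ := hA.2.1
    obtain ⟨n, hn, hn1⟩ := ((((tendsto_pow_atTop_atTop_of_one_lt hlam).const_mul_atTop
      hC).eventually_gt_atTop (3 / 2)).and (eventually_ge_atTop 1)).exists
    refine ⟨n, hn1, hn.trans_le ((hyp _ (h.mem_juliaSet hd hA hw) n hn1).trans_eq ?_)⟩
    rw [deriv_polyIter, norm_prod]
    refine Finset.prod_congr rfl fun k _ => ?_
    rw [← conj_iterate (by omega) le_rfl h.conj k w.2, ← OutsideDisk.iterate_powMap le_rfl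
      (by omega : d ≠ 0), hm, norm_mul, norm_pow, OutsideDisk.iterate_powMap, norm_pow, hw]
    simp

/-- The Böttcher parametrization depends holomorphically on the coefficients. -/
theorem exists_contDiffAt_family {d : ℕ} (hd : 2 ≤ d) {A : Fin (d - 1) → ℂ} (hA : A ∈ paramSpace d)
    {Psi : ℂ → ℂ} (h : IsBoettcherParam d (centredPoly d A) Psi) {n : WithTop ℕ∞} (hn : n ≠ 0) :
    ∃ V : (Fin (d - 1) → ℂ) → (OutsideDisk 1 →ᵇ ℂ), ContDiffAt ℂ n V A ∧
      (∀ w : OutsideDisk 1, w * V A w = Psi w) ∧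
      ∀ᶠ B in 𝓝 A, ∃ Phi, IsBoettcherParam d (centredPoly d B) Phi ∧
        ∀ w : OutsideDisk 1, Phi w = w * V B w := by
  have hd0 : d ≠ 0 := by omega
  have hw0 : ∀ w : OutsideDisk 1, (w : ℂ) ≠ 0 := OutsideDisk.ne_zero le_rfl
  obtain ⟨a, ha⟩ := h.exists_quotient
  obtain ⟨C, hC, κ, hκ, hgrow⟩ := h.exists_multiplier_growth hd hA ha
  have cdf : ContDiffAt ℂ n (boettcherFun d hd0) (A, a) := (contDiff_boettcherFun hd0).contDiffAt
  have inv := isInvertible_fderiv_boettcherFun hd0 A a hC hκ hgrow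
  have hF0 : boettcherFun d hd0 (A, a) = 0 := by
    ext w
    rw [boettcherFun_apply, BoundedContinuousFunction.coe_zero, Pi.zero_apply, sub_eq_zero]
    have h1 := centredPoly_eval_mul_scaledCoeff d A (hw0 w) (a w)
    rw [ha w, mul_div_cancel₀ _ (hw0 w), ← h.conj _ w.2, ← ha w] at h1
    rw [ha (OutsideDisk.powMap le_rfl hd0 w), eq_div_iff (hw0 _)]
    change _ * (w : ℂ) ^ d = Psi ((w : ℂ) ^ d)
    rw [h1, mul_comm]
  set V := cdf.implicitFunction hn inv with hV
  have hVA : V A = a := cdf.implicitFunction_apply_self hn inv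
  have hVc : ContDiffAt ℂ n V A := cdf.contDiffAt_implicitFunction hn inv
  refine ⟨V, hVc, fun w => by rw [hVA, ha, mul_div_cancel₀ _ (hw0 w)], ?_⟩
  -- This radius serves all coefficient vectors at once. Half of it bounds `Psi / w - 1` far out,
  -- the other half the change from `A` to `B`, so tangency at infinity survives the perturbation.
  obtain ⟨ε, hε⟩ := exists_isContractionRadius d
  obtain ⟨R, hR⟩ := eventually_cobounded_iff_norm.1
    ((h.tangent.sub_const 1).norm.eventually_le_const (u := ε / 2) (by simpa using hε.1))
  have hnear : ∀ᶠ B in 𝓝 A, dist (V B) a < ε / 2 := by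
    have := hVc.continuousAt.tendsto
    rw [hVA] at this
    exact Metric.tendsto_nhds.1 this _ (half_pos hε.1)
  filter_upwards [cdf.eventually_apply_implicitFunction hn inv, hnear] with B hB hBa
  rw [hF0] at hB
  classical
  let Phi : ℂ → ℂ := fun w => if hw : 1 ≤ ‖w‖ then w * V B ⟨w, hw⟩ else 0
  have hPhi : ∀ w : OutsideDisk 1, Phi w = w * V B w := fun w => dif_pos w.2
  have hconj : ∀ w : ℂ, 1 ≤ ‖w‖ → Phi (w ^ d) = (centredPoly d B).eval (Phi w) := by
    intro w hw
    have h1 := congrArg (fun f : OutsideDisk 1 →ᵇ ℂ => f ⟨w, hw⟩) hB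
    simp only [boettcherFun_apply, BoundedContinuousFunction.coe_zero, Pi.zero_apply,
      sub_eq_zero] at h1
    have h2 := hPhi ⟨w, hw⟩
    have h3 := hPhi (OutsideDisk.powMap le_rfl hd0 ⟨w, hw⟩)
    change Phi (w ^ d) = w ^ d * _ at h3
    dsimp only at h2
    rw [h2, h3, centredPoly_eval_mul_scaledCoeff d B (hw0 ⟨w, hw⟩), ← h1]
  refine ⟨Phi, ⟨?_, hconj, ?_⟩, hPhi⟩
  · rw [continuousOn_iff_continuous_domRestrict]
    have : ({w : ℂ | 1 ≤ ‖w‖}.domRestrict Phi) = fun w : OutsideDisk 1 => (w : ℂ) * V B w :=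
      funext fun w => hPhi w
    rw [this]
    fun_prop
  · refine hε.tangent hd (R := max 1 R) (fun w hw => hconj w ((le_max_left _ _).trans hw))
      fun w hw => ?_
    have hw1 : 1 ≤ ‖w‖ := (le_max_left _ _).trans hw
    have h1 := hPhi ⟨w, hw1⟩
    have h2 := hR w ((le_max_right _ _).trans hw)
    have h3 := (BoundedContinuousFunction.dist_coe_le_dist (f := V B) (g := a) ⟨w, hw1⟩).trans hBa.le
    rw [ha, dist_eq_norm] at h3
    dsimp only at h1 h3
    rw [h1, mul_div_cancel_left₀ _ (hw0 ⟨w, hw1⟩)]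
    have h4 := norm_add_le (V B ⟨w, hw1⟩ - Psi w / w) (Psi w / w - 1)
    rw [sub_add_sub_cancel] at h4
    linarith

end IsBoettcherParam

/-! ### The limiting measure on angles. -/

/-- The average of `g` over the preimages of order `n` of the angle `θ`, weighted by `p`. -/
noncomputable def wordAverage (d : ℕ) (p : Fin d → ℝ) (n : ℕ) (g : ℝ → ℝ) (θ : ℝ) : ℝ :=
  ∑ η : Fin n → Fin d, (∏ i, p (η i)) * g (wordAngle d n η θ)

/-- The recursive definition peels off the last letter; peeling off the first, which only moves the
starting angle, is what turns averages of order `n + 1` into averages of averages of order `n`. -/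
theorem wordAngle_cons (d n : ℕ) (j : Fin d) (η : Fin n → Fin d) (θ : ℝ) :
    wordAngle d (n + 1) (Fin.cons j η) θ = wordAngle d n η (branchAngle d j θ) := by
  induction n with
  | zero => rfl
  | succ n ih =>
    change branchAngle d _ (wordAngle d (n + 1) _ θ) =
      branchAngle d _ (wordAngle d n _ (branchAngle d j θ))
    rw [← ih]
    refine congrArg₂ (branchAngle d) rfl (congrArg (wordAngle d (n + 1) · θ) (funext fun i => ?_))
    refine Fin.cases rfl (fun i => ?_) i
    rw [← Fin.succ_castSucc, Fin.cons_succ, Fin.cons_succ]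

theorem branchAngle_mem_Icc {d : ℕ} (j : Fin d) {θ : ℝ} (hθ : θ ∈ Icc (0 : ℝ) 1) :
    branchAngle d j θ ∈ Icc (0 : ℝ) 1 := by
  have hj : ((j : ℕ) : ℝ) + 1 ≤ d := by exact_mod_cast j.2
  have h0 : (0 : ℝ) ≤ (j : ℕ) := Nat.cast_nonneg _
  have hd : (0 : ℝ) < d := by linarith
  rw [branchAngle]
  exact ⟨div_nonneg (by linarith [hθ.1]) hd.le, (div_le_one hd).2 (by linarith [hθ.2])⟩

theorem wordAngle_mem_Icc {d : ℕ} (n : ℕ) (η : Fin n → Fin d) {θ : ℝ} (hθ : θ ∈ Icc (0 : ℝ) 1) :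
    wordAngle d n η θ ∈ Icc (0 : ℝ) 1 := by
  induction n with
  | zero => exact hθ
  | succ n ih => exact branchAngle_mem_Icc _ (ih _)

theorem wordAngle_sub_wordAngle (d n : ℕ) (η : Fin n → Fin d) (θ θ' : ℝ) :
    wordAngle d n η θ - wordAngle d n η θ' = (θ - θ') / d ^ n := by
  induction n with
  | zero => simp [wordAngle]
  | succ n ih =>
    rw [wordAngle, wordAngle, branchAngle, branchAngle, ← sub_div, add_sub_add_right_eq_sub, ih,
      div_div, pow_succ]

theorem wordAverage_succ (d : ℕ) (p : Fin d → ℝ) (n : ℕ) (g : ℝ → ℝ) (θ : ℝ) :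
    wordAverage d p (n + 1) g θ = ∑ j, p j * wordAverage d p n g (branchAngle d j θ) := by
  simp only [wordAverage, Finset.mul_sum]
  rw [← Fintype.sum_prod_type', ← (Fin.consEquiv fun _ => Fin d).sum_comp]
  refine Finset.sum_congr rfl fun q _ => ?_
  change (∏ i, p ((Fin.cons q.1 q.2 : Fin (n + 1) → Fin d) i)) *
    g (wordAngle d (n + 1) (Fin.cons q.1 q.2) θ) = _
  rw [wordAngle_cons, Fin.prod_univ_succ]
  simp only [Fin.cons_zero, Fin.cons_succ, mul_assoc]

theorem sum_prod_weights {d : ℕ} {p : Fin d → ℝ} (hsum : ∑ j, p j = 1) (n : ℕ) :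
    ∑ η : Fin n → Fin d, ∏ i, p (η i) = 1 := by
  rw [← Fintype.sum_pow, hsum, one_pow]

/-- For equal orders the same word sends two starting angles to within `d ^ (-n)` of each other, so
uniform continuity suffices. A higher order is a convex combination of lower ones at other starting
angles, which keeps the same bound. -/
theorem exists_abs_wordAverage_sub_le {d : ℕ} (hd : 2 ≤ d) {p : Fin d → ℝ} (hp : ∀ j, 0 ≤ p j)
    (hsum : ∑ j, p j = 1) {g : ℝ → ℝ} (hg : Continuous g) {ε : ℝ} (hε : 0 < ε) :
    ∃ N, ∀ n ≥ N, ∀ m ≥ n, ∀ θ ∈ Icc (0 : ℝ) 1, ∀ θ' ∈ Icc (0 : ℝ) 1,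
      |wordAverage d p m g θ - wordAverage d p n g θ'| ≤ ε := by
  obtain ⟨δ, hδ, hgδ⟩ := Metric.uniformContinuousOn_iff.1
    (isCompact_Icc.uniformContinuousOn_of_continuous hg.continuousOn) ε hε
  have hd1 : (1 : ℝ) < d := by exact_mod_cast (by omega : 1 < d)
  obtain ⟨N, hN⟩ := ((tendsto_pow_atTop_atTop_of_one_lt hd1).eventually_gt_atTop δ⁻¹).exists_forall_of_atTop
  refine ⟨N, fun n hn m hm => ?_⟩
  induction m, hm using Nat.le_induction with
  | base =>
    intro θ hθ θ' hθ'
    rw [wordAverage, wordAverage, ← Finset.sum_sub_distrib]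
    refine (Finset.abs_sum_le_sum_abs _ _).trans ?_
    rw [← one_mul ε, ← sum_prod_weights hsum n, Finset.sum_mul]
    refine Finset.sum_le_sum fun η _ => ?_
    have h0 : 0 ≤ ∏ i, p (η i) := Finset.prod_nonneg fun i _ => hp _
    rw [← mul_sub, abs_mul, abs_of_nonneg h0]
    refine mul_le_mul_of_nonneg_left (hgδ _ (wordAngle_mem_Icc n η hθ) _
      (wordAngle_mem_Icc n η hθ') ?_).le h0
    have hdn : (0 : ℝ) < d ^ n := by positivity
    rw [Real.dist_eq, wordAngle_sub_wordAngle, abs_div, abs_of_pos hdn, div_lt_iff₀ hdn]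
    calc |θ - θ'| ≤ 1 := by rw [abs_le]; constructor <;> linarith [hθ.1, hθ.2, hθ'.1, hθ'.2]
      _ = δ * δ⁻¹ := (mul_inv_cancel₀ hδ.ne').symm
      _ < δ * d ^ n := mul_lt_mul_of_pos_left (hN n hn) hδ
  | succ m _ ih =>
    intro θ hθ θ' hθ'
    rw [wordAverage_succ, ← one_mul (wordAverage d p n g θ'), ← hsum, Finset.sum_mul,
      ← Finset.sum_sub_distrib]
    refine (Finset.abs_sum_le_sum_abs _ _).trans ?_
    rw [← one_mul ε, ← hsum, Finset.sum_mul]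
    refine Finset.sum_le_sum fun j _ => ?_
    rw [← mul_sub, abs_mul, abs_of_nonneg (hp j)]
    exact mul_le_mul_of_nonneg_left (ih _ (branchAngle_mem_Icc j hθ) _ hθ') (hp j)

theorem integral_sum_ofReal_smul_dirac {X ι E : Type*} [Fintype ι] [TopologicalSpace X]
    [MeasurableSpace X] [OpensMeasurableSpace X] [NormedAddCommGroup E] [NormedSpace ℝ E]
    [CompleteSpace E] [SecondCountableTopology E]
    {c : ι → ℝ} (hc : ∀ i, 0 ≤ c i) (x : ι → X) {f : X → E} (hf : Continuous f) :
    ∫ y, f y ∂(∑ i, ENNReal.ofReal (c i) • Measure.dirac (x i)) = ∑ i, c i • f (x i) := by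
  borelize E
  have hf' : StronglyMeasurable f := hf.measurable.stronglyMeasurable
  have hint : ∀ i, Integrable f (Measure.dirac (x i)) := fun i =>
    (integrable_dirac' hf' (by simp))
  rw [integral_finsetSum_measure fun i _ => (hint i).smul_measure ENNReal.ofReal_ne_top]
  refine Finset.sum_congr rfl fun i _ => ?_
  rw [integral_smul_measure, integral_dirac' f _ hf', ENNReal.toReal_ofReal (hc i)]

/-- The weighted averages over the preimages of an angle converge to the integral with respect to
a probability measure on the angles. -/
theorem exists_limit_wordAverage {d : ℕ} (hd : 2 ≤ d) {p : Fin d → ℝ} (hp : ∀ j, 0 ≤ p j)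
    (hsum : ∑ j, p j = 1) : ∃ ν : Measure ℝ, IsProbabilityMeasure ν ∧ ∀ g : ℝ → ℝ, Continuous g →
      ∀ θ ∈ Icc (0 : ℝ) 1, Tendsto (fun n => wordAverage d p n g θ) atTop (𝓝 (∫ t, g t ∂ν)) := by
  have h0 : (0 : ℝ) ∈ Icc (0 : ℝ) 1 := by simp
  have hc : ∀ n (η : Fin n → Fin d), 0 ≤ ∏ i, p (η i) := fun n η =>
    Finset.prod_nonneg fun i _ => hp _
  let M : ℕ → ProbabilityMeasure (Icc (0 : ℝ) 1) := fun n =>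
    ⟨∑ η : Fin n → Fin d, ENNReal.ofReal (∏ i, p (η i)) •
      Measure.dirac ⟨wordAngle d n η 0, wordAngle_mem_Icc n η h0⟩, ⟨by
        simp only [Measure.coe_finsetSum, Finset.sum_apply, Measure.smul_apply, measure_univ,
          smul_eq_mul, mul_one]
        rw [← ENNReal.ofReal_sum_of_nonneg fun η _ => hc n η, sum_prod_weights hsum,
          ENNReal.ofReal_one]⟩⟩
  -- Compactness of the probability measures on `[0, 1]` produces a candidate along an ultrafilter;
  -- the Cauchy estimate identifies its integrals with the genuine limits.
  let U : Ultrafilter ℕ := Ultrafilter.of atTop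
  obtain ⟨ν, -, hν⟩ := isCompact_univ.ultrafilter_le_nhds (U.map M) (by simp)
  have hν' : Tendsto M U (𝓝 ν) := hν
  rw [ProbabilityMeasure.tendsto_iff_forall_integral_tendsto] at hν'
  refine ⟨(ν : Measure (Icc (0 : ℝ) 1)).map Subtype.val,
    Measure.isProbabilityMeasure_map measurable_subtype_coe.aemeasurable, fun g hg θ hθ => ?_⟩
  rw [integral_map measurable_subtype_coe.aemeasurable hg.aestronglyMeasurable]
  have hgI : Continuous fun t : Icc (0 : ℝ) 1 => g t := hg.comp continuous_subtype_val
  have hU := hν' (BoundedContinuousFunction.mkOfCompact ⟨_, hgI⟩)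
  have hM : ∀ n, ∫ t, BoundedContinuousFunction.mkOfCompact ⟨_, hgI⟩ t ∂(M n : Measure _) =
      wordAverage d p n g 0 := fun n =>
    integral_sum_ofReal_smul_dirac (hc n) _ hgI
  simp only [hM] at hU
  have hCauchy : CauchySeq fun n => wordAverage d p n g θ := by
    refine Metric.cauchySeq_iff'.2 fun ε hε => ?_
    obtain ⟨N, hN⟩ := exists_abs_wordAverage_sub_le hd hp hsum hg (half_pos hε)
    exact ⟨N, fun n hn => (hN N le_rfl n hn θ hθ θ hθ).trans_lt (half_lt_self hε)⟩
  obtain ⟨L, hL⟩ := cauchySeq_tendsto_of_complete hCauchy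
  have hdiff : Tendsto (fun n => wordAverage d p n g 0 - wordAverage d p n g θ) atTop (𝓝 0) := by
    refine Metric.tendsto_atTop.2 fun ε hε => ?_
    obtain ⟨N, hN⟩ := exists_abs_wordAverage_sub_le hd hp hsum hg (half_pos hε)
    refine ⟨N, fun n hn => ?_⟩
    rw [dist_zero_right]
    exact (hN n hn n le_rfl 0 h0 θ hθ).trans_lt (half_lt_self hε)
  have hL0 : Tendsto (fun n => wordAverage d p n g 0) atTop (𝓝 L) := by
    simpa using hdiff.add hL
  have := tendsto_nhds_unique hU (hL0.mono_left (Ultrafilter.of_le atTop))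
  simp only [BoundedContinuousFunction.mkOfCompact_apply, ContinuousMap.coe_mk] at this
  rw [this]
  exact hL

/-! ### The weighted Lyubich measure as an image of the angle measure. -/

theorem norm_circlePt (θ : ℝ) : ‖circlePt θ‖ = 1 := by
  have : circlePt θ = Complex.exp ((2 * Real.pi * θ : ℝ) * Complex.I) := by
    rw [circlePt]; push_cast; rfl
  rw [this, Complex.norm_exp_ofReal_mul_I]

theorem continuous_circlePt : Continuous circlePt := by
  unfold circlePt
  fun_prop

theorem IsBoettcherParam.continuous_comp_circlePt {d : ℕ} {P : Polynomial ℂ} {Psi : ℂ → ℂ}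
    (h : IsBoettcherParam d P Psi) : Continuous fun θ => Psi (circlePt θ) :=
  h.continuousOn.comp_continuous continuous_circlePt fun θ => (norm_circlePt θ).ge

theorem integral_weightedPreimageMeasure {d : ℕ} {p : Fin d → ℝ} (hp : ∀ j, 0 ≤ p j) (Psi : ℂ → ℂ)
    (θ : ℝ) (n : ℕ) {f : ℂ → ℝ} (hf : Continuous f) :
    ∫ z, f z ∂(weightedPreimageMeasure d p Psi θ n) =
      wordAverage d p n (fun t => f (Psi (circlePt t))) θ :=
  integral_sum_ofReal_smul_dirac (fun _ => Finset.prod_nonneg fun _ _ => hp _) _ hf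

theorem IsBoettcherParam.isWeightedLyubichMeasure_map {d : ℕ} {p : Fin d → ℝ} (hp : ∀ j, 0 ≤ p j)
    {P : Polynomial ℂ} {Psi : ℂ → ℂ} (h : IsBoettcherParam d P Psi) {ν : Measure ℝ}
    [IsProbabilityMeasure ν] (hν : ∀ g : ℝ → ℝ, Continuous g → ∀ θ ∈ Icc (0 : ℝ) 1,
      Tendsto (fun n => wordAverage d p n g θ) atTop (𝓝 (∫ t, g t ∂ν))) :
    IsWeightedLyubichMeasure d P p (ν.map fun θ => Psi (circlePt θ)) := by
  have hc := h.continuous_comp_circlePt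
  refine ⟨Measure.isProbabilityMeasure_map hc.measurable.aemeasurable, Psi, h, fun θ hθ f => ?_⟩
  rw [integral_map hc.measurable.aemeasurable f.continuous.aestronglyMeasurable]
  simp only [integral_weightedPreimageMeasure hp Psi θ _ f.continuous]
  exact hν _ (f.continuous.comp hc) θ ⟨hθ.1, hθ.2.le⟩

/-- The preimage measures only see `Psi` on the circle, where it is determined by `P`. Both measures
are thus weak limits of one sequence. -/
theorem IsWeightedLyubichMeasure.unique {d : ℕ} (hd : 2 ≤ d) {p : Fin d → ℝ} (hp : ∀ j, 0 ≤ p j)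
    {B : Fin (d - 1) → ℂ} (hb : HasBoundedCriticalOrbits (centredPoly d B)) {μ μ' : Measure ℂ}
    (hμ : IsWeightedLyubichMeasure d (centredPoly d B) p μ)
    (hμ' : IsWeightedLyubichMeasure d (centredPoly d B) p μ') : μ = μ' := by
  obtain ⟨h1, Psi, hPsi, hlim⟩ := hμ
  obtain ⟨h2, Phi, hPhi, hlim'⟩ := hμ'
  have heq : ∀ t, Psi (circlePt t) = Phi (circlePt t) := fun t =>
    IsBoettcherParam.eqOn hd hb hPsi hPhi (norm_circlePt t).ge
  refine ext_of_forall_integral_eq_of_IsFiniteMeasure fun f => ?_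
  refine tendsto_nhds_unique (hlim 0 (by simp) f) ((hlim' 0 (by simp) f).congr fun n => ?_)
  rw [integral_weightedPreimageMeasure hp _ _ _ f.continuous,
    integral_weightedPreimageMeasure hp _ _ _ f.continuous]
  simp only [heq]

theorem IsBoettcherParam.weightedLyubichMeasure_eq {d : ℕ} (hd : 2 ≤ d) {p : Fin d → ℝ}
    (hp : ∀ j, 0 ≤ p j) {B : Fin (d - 1) → ℂ} (hb : HasBoundedCriticalOrbits (centredPoly d B))
    {Psi : ℂ → ℂ} (h : IsBoettcherParam d (centredPoly d B) Psi) {ν : Measure ℝ}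
    [IsProbabilityMeasure ν] (hν : ∀ g : ℝ → ℝ, Continuous g → ∀ θ ∈ Icc (0 : ℝ) 1,
      Tendsto (fun n => wordAverage d p n g θ) atTop (𝓝 (∫ t, g t ∂ν))) :
    weightedLyubichMeasure d (centredPoly d B) p = ν.map fun θ => Psi (circlePt θ) := by
  have hm := h.isWeightedLyubichMeasure_map hp hν
  have hex : ∃ μ, IsWeightedLyubichMeasure d (centredPoly d B) p μ := ⟨_, hm⟩
  rw [weightedLyubichMeasure, dif_pos hex]
  exact hex.choose_spec.unique hd hp hb hm

theorem map_comp_circlePt_compl_juliaSet {d : ℕ} (hd : 2 ≤ d) {B : Fin (d - 1) → ℂ}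
    (hB : B ∈ paramSpace d) {Psi : ℂ → ℂ} (h : IsBoettcherParam d (centredPoly d B) Psi)
    (ν : Measure ℝ) :
    ν.map (fun θ => Psi (circlePt θ)) (juliaSet (centredPoly d B))ᶜ = 0 := by
  have hJ : IsClosed (juliaSet (centredPoly d B)) := isClosed_frontier
  rw [Measure.map_apply h.continuous_comp_circlePt.measurable hJ.measurableSet.compl]
  convert measure_empty (μ := ν)
  ext θ
  simpa using h.mem_juliaSet hd hB (norm_circlePt θ)

theorem integrableOn_log_derivative {d : ℕ} (hd : 2 ≤ d) {B : Fin (d - 1) → ℂ}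
    (hB : B ∈ paramSpace d) (μ : Measure ℂ) [IsFiniteMeasure μ] :
    IntegrableOn (fun z => Real.log ‖(centredPoly d B).derivative.eval z‖)
      (juliaSet (centredPoly d B)) μ := by
  refine ContinuousOn.integrableOn_compact
    (isCompact_juliaSet hd fun r => (norm_lt_one_of_mem_paramSpace hB r).le) ?_
  refine ContinuousOn.log (Polynomial.continuous _).norm.continuousOn fun z hz => ?_
  exact norm_ne_zero_iff.2 (derivative_eval_ne_zero_of_mem_juliaSet hB.2.1 hz)

/-- The integral moves to the angles, where the measure `ν` is the same for every `B`; this permits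
differentiation in the coefficients. -/
theorem lyapunovFun_eq {d : ℕ} (hd : 2 ≤ d) {p : Fin d → ℝ} (hp : ∀ j, 0 ≤ p j)
    {B : Fin (d - 1) → ℂ} (hB : B ∈ paramSpace d) {Psi : ℂ → ℂ}
    (h : IsBoettcherParam d (centredPoly d B) Psi) {ν : Measure ℝ}
    [IsProbabilityMeasure ν] (hν : ∀ g : ℝ → ℝ, Continuous g → ∀ θ ∈ Icc (0 : ℝ) 1,
      Tendsto (fun n => wordAverage d p n g θ) atTop (𝓝 (∫ t, g t ∂ν))) :
    lyapunovFun d p B =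
      -∫ θ, Real.log ‖(centredPoly d B).derivative.eval (Psi (circlePt θ))‖ ∂ν := by
  have hc := h.continuous_comp_circlePt
  rw [lyapunovFun, lyapunovExponent, h.weightedLyubichMeasure_eq hd hp hB.2.2 hν,
    Measure.restrict_eq_self_of_ae_mem (s := juliaSet (centredPoly d B))
      (mem_ae_iff.2 (map_comp_circlePt_compl_juliaSet hd hB h ν)),
    integral_map hc.measurable.aemeasurable]
  exact ((Polynomial.continuous _).norm.measurable.log).aestronglyMeasurable

/-! ### Holomorphic logarithms and pluriharmonicity. -/

/-- A differentiable family in a commutative Banach algebra has a differentiable family of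
logarithms near an invertible value. -/
theorem ContDiffAt.exists_log {E R : Type*} [NormedAddCommGroup E] [NormedSpace ℂ E]
    [NormedCommRing R] [NormedAlgebra ℂ R] [CompleteSpace R] {n : WithTop ℕ∞} (hn : n ≠ 0)
    {f : E → R} {a : E} (hf : ContDiffAt ℂ n f a) (ha : IsUnit (f a)) :
    ∃ G : E → R, ContDiffAt ℂ n G a ∧ ∀ᶠ x in 𝓝 a, f x = f a * NormedSpace.exp (G x) := by
  obtain ⟨u, hu⟩ := ha
  have hexp : ContDiffAt ℂ n (NormedSpace.exp : R → R) 0 :=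
    (NormedSpace.exp_analytic (𝕂 := ℂ) (0 : R)).contDiffAt
  have hd : HasFDerivAt (NormedSpace.exp : R → R)
      ((ContinuousLinearEquiv.refl ℂ R : R ≃L[ℂ] R) : R →L[ℂ] R) 0 :=
    (hasStrictFDerivAt_exp_zero (𝕂 := ℂ) (𝔸 := R)).hasFDerivAt
  have hL := hexp.to_localInverse hd hn
  have hright := (hexp.hasStrictFDerivAt' hd hn).eventually_right_inverse
  have hq : ContDiffAt ℂ n (fun x => ((u⁻¹ : Rˣ) : R) * f x) a := contDiffAt_const.mul hf
  have hqa : ((u⁻¹ : Rˣ) : R) * f a = NormedSpace.exp (0 : R) := by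
    rw [← hu, Units.inv_mul, NormedSpace.exp_zero]
  rw [← hqa] at hL hright
  refine ⟨_, hL.comp a hq, ?_⟩
  filter_upwards [hq.continuousAt.eventually hright] with x hx
  change f x = f a * NormedSpace.exp (HasStrictFDerivAt.localInverse _ _ _ _ _)
  rw [hx, ← hu, ← mul_assoc, Units.mul_inv, one_mul]

/-- Integration of bounded continuous functions, as a continuous linear map. -/
noncomputable def BoundedContinuousFunction.integralCLM {X : Type*} [TopologicalSpace X]
    [MeasurableSpace X] [OpensMeasurableSpace X] (ν : Measure X) [IsProbabilityMeasure ν] :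
    (X →ᵇ ℂ) →L[ℂ] ℂ :=
  LinearMap.mkContinuous
    { toFun := fun f => ∫ x, f x ∂ν
      map_add' := fun f g => integral_add (f.integrable ν) (g.integrable ν)
      map_smul' := fun c f => integral_const_mul c _ } 1 fun f => by
    rw [one_mul]
    exact f.norm_integral_le_norm ν

theorem deriv_line_of_eventuallyEq_re {m : ℕ} {F : (Fin m → ℂ) → ℝ} {g : (Fin m → ℂ) → ℂ} {c : ℝ}
    {B : Fin m → ℂ} (hF : F =ᶠ[𝓝 B] fun B => c - (g B).re) (hg : DifferentiableAt ℂ g B)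
    (v : Fin m → ℂ) :
    deriv (fun t : ℝ => F (B + (t : ℂ) • v)) 0 = -(fderiv ℂ g B v).re := by
  have hl : HasDerivAt (fun t : ℂ => B + t • v) v 0 := by
    simpa using ((hasDerivAt_id (0 : ℂ)).smul_const v).const_add B
  have hB : B + (0 : ℂ) • v = B := by simp
  have h1 : HasDerivAt (fun t : ℂ => g (B + t • v)) (fderiv ℂ g B v) 0 := by
    refine HasFDerivAt.comp_hasDerivAt (0 : ℂ) ?_ hl
    rw [hB]
    exact hg.hasFDerivAt
  have h2 := HasDerivAt.real_of_complex (z := 0) (by exact_mod_cast h1)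
  have hc : Tendsto (fun t : ℝ => B + (t : ℂ) • v) (𝓝 0) (𝓝 B) := by
    have : Continuous fun t : ℝ => B + (t : ℂ) • v := by fun_prop
    simpa using this.tendsto 0
  exact (EventuallyEq.deriv_eq (f := fun t : ℝ => c - (g (B + (t : ℂ) • v)).re)
    (hc.eventually hF)).trans (h2.const_sub c).deriv

theorem partialRe_eq_of_eventuallyEq_re {m : ℕ} {F : (Fin m → ℂ) → ℝ} {g : (Fin m → ℂ) → ℂ} {c : ℝ}
    {B : Fin m → ℂ} (hF : F =ᶠ[𝓝 B] fun B => c - (g B).re) (hg : DifferentiableAt ℂ g B)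
    (r : Fin m) : partialRe r F B = -(fderiv ℂ g B (Pi.single r 1)).re := by
  rw [← deriv_line_of_eventuallyEq_re hF hg, partialRe]
  simp [← Pi.single_smul]

theorem partialIm_eq_of_eventuallyEq_re {m : ℕ} {F : (Fin m → ℂ) → ℝ} {g : (Fin m → ℂ) → ℂ} {c : ℝ}
    {B : Fin m → ℂ} (hF : F =ᶠ[𝓝 B] fun B => c - (g B).re) (hg : DifferentiableAt ℂ g B)
    (r : Fin m) : partialIm r F B = -(Complex.I * fderiv ℂ g B (Pi.single r 1)).re := by
  rw [← smul_eq_mul, ← map_smul, ← deriv_line_of_eventuallyEq_re hF hg, partialIm]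
  simp [← Pi.single_smul]

/-- The real part of a holomorphic function is pluriharmonic. -/
theorem partialRe_partialRe_eq_neg_of_eventuallyEq_re {m : ℕ} {F : (Fin m → ℂ) → ℝ}
    {g : (Fin m → ℂ) → ℂ} {c : ℝ} {A : Fin m → ℂ} (hF : F =ᶠ[𝓝 A] fun B => c - (g B).re)
    (hg : ContDiffAt ℂ 2 g A) (r s : Fin m) :
    partialRe r (partialRe s F) A = -partialIm r (partialIm s F) A := by
  have hd : ∀ᶠ B in 𝓝 A, DifferentiableAt ℂ g B :=
    (hg.eventually (by simp)).mono fun B hB => hB.differentiableAt (by simp)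
  let g₁ : (Fin m → ℂ) → ℂ := fun B => fderiv ℂ g B (Pi.single s 1)
  have hg₁ : DifferentiableAt ℂ g₁ A :=
    ((hg.fderiv_right (m := 1) (by norm_num)).differentiableAt one_ne_zero).clm_apply
      (differentiableAt_const _)
  -- First derivatives again have the form of a constant minus a holomorphic real part, so the
  -- first-order formulas apply a second time.
  have hRe : partialRe s F =ᶠ[𝓝 A] fun B => 0 - (g₁ B).re := by
    filter_upwards [hF.eventuallyEq_nhds, hd] with B hB hdB
    rw [partialRe_eq_of_eventuallyEq_re hB hdB, zero_sub]
  have hIm : partialIm s F =ᶠ[𝓝 A] fun B => 0 - (Complex.I * g₁ B).re := by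
    filter_upwards [hF.eventuallyEq_nhds, hd] with B hB hdB
    rw [partialIm_eq_of_eventuallyEq_re hB hdB, zero_sub]
  rw [partialRe_eq_of_eventuallyEq_re hRe hg₁,
    partialIm_eq_of_eventuallyEq_re hIm (hg₁.const_mul _), fderiv_const_mul hg₁]
  simp [← mul_assoc]

theorem contDiffAt_real_of_eventuallyEq_re {m : ℕ} {F : (Fin m → ℂ) → ℝ}
    {g : (Fin m → ℂ) → ℂ} {c : ℝ} {A : Fin m → ℂ} (hF : F =ᶠ[𝓝 A] fun B => c - (g B).re)
    {n : WithTop ℕ∞} (hg : ContDiffAt ℂ n g A) : ContDiffAt ℝ n F A :=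
  ContDiffAt.congr_of_eventuallyEq (contDiffAt_const.sub
    (Complex.reCLM.contDiff.contDiffAt.comp A (hg.restrict_scalars ℝ))) hF

/-- The angle parametrization of the unit circle, as a map to `1 ≤ |w|`. -/
noncomputable def circleAngleMap : C(ℝ, OutsideDisk 1) :=
  ⟨fun θ => ⟨circlePt θ, (norm_circlePt θ).ge⟩, continuous_circlePt.subtype_mk _⟩

/-- The Lyapunov exponent is locally the real part of a holomorphic function. -/
theorem exists_lyapunovFun_eventuallyEq_re {d : ℕ} (hd : 2 ≤ d) {p : Fin d → ℝ} (hp : ∀ j, 0 ≤ p j)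
    {A : Fin (d - 1) → ℂ} (hA : A ∈ paramSpace d) {ν : Measure ℝ}
    [IsProbabilityMeasure ν] (hν : ∀ g : ℝ → ℝ, Continuous g → ∀ θ ∈ Icc (0 : ℝ) 1,
      Tendsto (fun n => wordAverage d p n g θ) atTop (𝓝 (∫ t, g t ∂ν)))
    {n : WithTop ℕ∞} (hn : n ≠ 0) :
    ∃ (g : (Fin (d - 1) → ℂ) → ℂ) (c : ℝ), ContDiffAt ℂ n g A ∧
      lyapunovFun d p =ᶠ[𝓝 A] fun B => c - (g B).re := by
  obtain ⟨Psi, hPsi⟩ := exists_isBoettcherParam hd hA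
  obtain ⟨V, hV, hVA, hVB⟩ := hPsi.exists_contDiffAt_family hd hA hn
  let c : ℝ →ᵇ ℂ := BoundedContinuousFunction.ofNormedAddCommGroup circlePt continuous_circlePt 1
    fun θ => (norm_circlePt θ).le
  let q : (Fin (d - 1) → ℂ) → (ℝ →ᵇ ℂ) := fun B =>
    c * BoundedContinuousFunction.compContinuousCLM ℂ ℂ circleAngleMap (V B)
  have hq : ContDiffAt ℂ n q A :=
    contDiffAt_const.mul ((ContinuousLinearMap.contDiff _).contDiffAt.comp A hV)
  have hqB : ∀ B θ, q B θ = circlePt θ * V B (circleAngleMap θ) := fun B θ => rfl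
  let f : (Fin (d - 1) → ℂ) → (ℝ →ᵇ ℂ) := fun B => (d : ℂ) • q B ^ (d - 1) +
    ∑ r : Fin (d - 1), B r • (((r : ℕ) : ℂ) • q B ^ ((r : ℕ) - 1))
  have hf : ContDiffAt ℂ n f A := by
    refine ((hq.pow _).const_smul (d : ℂ)).add (ContDiffAt.sum fun r _ => ?_)
    exact (contDiff_apply ℂ ℂ r).contDiffAt.smul ((hq.pow _).const_smul ((r : ℕ) : ℂ))
  have hfB : ∀ B θ, f B θ = (centredPoly d B).derivative.eval (q B θ) := by
    intro B θ
    rw [centredPoly_derivative_eval]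
    simp [f]
  have hqA : ∀ θ, q A θ = Psi (circlePt θ) := fun θ => hVA (circleAngleMap θ)
  -- Having no zeros is not enough for a unit among bounded functions on `ℝ`; the inverse is bounded
  -- because the values lie in the compact Julia set.
  have hunit : IsUnit (f A) := by
    have hne := fun z (hz : z ∈ juliaSet (centredPoly d A)) =>
      derivative_eval_ne_zero_of_mem_juliaSet hA.2.1 hz
    have hmem : ∀ θ, q A θ ∈ juliaSet (centredPoly d A) := fun θ => by
      rw [hqA]; exact hPsi.mem_juliaSet hd hA (norm_circlePt θ)
    have hcont : ContinuousOn (fun z => ((centredPoly d A).derivative.eval z)⁻¹)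
        (juliaSet (centredPoly d A)) := (Polynomial.continuous _).continuousOn.inv₀ hne
    obtain ⟨M, hM⟩ := (isCompact_juliaSet hd fun r =>
      (norm_lt_one_of_mem_paramSpace hA r).le).exists_bound_of_continuousOn hcont
    let i : ℝ →ᵇ ℂ := BoundedContinuousFunction.ofNormedAddCommGroup
      (fun θ => ((centredPoly d A).derivative.eval (q A θ))⁻¹)
      (hcont.comp_continuous (q A).continuous hmem) M fun θ => hM _ (hmem θ)
    refine IsUnit.of_mul_eq_one i ?_
    ext θ
    change f A θ * ((centredPoly d A).derivative.eval (q A θ))⁻¹ = 1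
    rw [hfB, mul_inv_cancel₀ (hne _ (hmem θ))]
  obtain ⟨G, hG, hGf⟩ := hf.exists_log hn hunit
  have hfA : ∀ θ, f A θ ≠ 0 := by
    intro θ h0
    obtain ⟨u, hu⟩ := hunit
    have h1 : (f A * (u⁻¹ : (ℝ →ᵇ ℂ)ˣ)) θ = 1 := by rw [← hu, Units.mul_inv]; rfl
    rw [BoundedContinuousFunction.coe_mul, Pi.mul_apply, h0, zero_mul] at h1
    exact zero_ne_one h1
  -- Evaluation at a point is a continuous ring homomorphism, so it carries the exponential of the
  -- algebra to the complex one.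
  have hev : ∀ (θ : ℝ) (x : ℝ →ᵇ ℂ), NormedSpace.exp x θ = Complex.exp (x θ) := by
    intro θ x
    let ev : (ℝ →ᵇ ℂ) →+* ℂ :=
      { toFun := fun x => x θ
        map_one' := rfl
        map_mul' := fun _ _ => rfl
        map_zero' := rfl
        map_add' := fun _ _ => rfl }
    have hevc : Continuous ev := (BoundedContinuousFunction.evalCLM ℂ θ).continuous
    rw [Complex.exp_eq_exp_ℂ]
    exact NormedSpace.map_exp_of_mem_ball (𝕂 := ℂ) ev hevc x
      ((NormedSpace.expSeries_radius_eq_top ℂ (ℝ →ᵇ ℂ)).symm ▸ edist_lt_top _ _)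
  refine ⟨fun B => BoundedContinuousFunction.integralCLM ν (G B), -∫ θ, Real.log ‖f A θ‖ ∂ν,
    (ContinuousLinearMap.contDiff _).contDiffAt.comp A hG, ?_⟩
  have hlogint : Integrable (fun θ => Real.log ‖f A θ‖) ν := by
    have hm := (hPsi.isWeightedLyubichMeasure_map hp hν).1
    have h1 := integrableOn_log_derivative hd hA (ν.map fun θ => Psi (circlePt θ))
    rw [IntegrableOn, Measure.restrict_eq_self_of_ae_mem (s := juliaSet (centredPoly d A))
      (mem_ae_iff.2 (map_comp_circlePt_compl_juliaSet hd hA hPsi ν))] at h1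
    simpa only [hfB, hqA] using! h1.comp_aemeasurable hPsi.continuous_comp_circlePt.aemeasurable
  filter_upwards [eventually_mem_paramSpace hd hA, hVB, hGf] with B hB ⟨Phi, hPhi, hPhiV⟩ hBf
  rw [lyapunovFun_eq hd hp hB hPhi hν]
  -- From `f B = f A * exp (G B)`: the logarithm of the modulus splits into a term independent of
  -- `B` and the real part of a holomorphic one.
  have hlog : ∀ θ, Real.log ‖(centredPoly d B).derivative.eval (Phi (circlePt θ))‖ =
      Real.log ‖f A θ‖ + (G B θ).re := by
    intro θ
    have h1 : Phi (circlePt θ) = q B θ := hPhiV (circleAngleMap θ)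
    rw [h1, ← hfB, hBf, BoundedContinuousFunction.coe_mul, Pi.mul_apply, hev, norm_mul,
      Complex.norm_exp, Real.log_mul (norm_ne_zero_iff.2 (hfA θ)) (Real.exp_ne_zero _),
      Real.log_exp]
  have hre : ∫ θ, (G B θ).re ∂ν = (∫ θ, G B θ ∂ν).re := integral_re ((G B).integrable ν)
  simp only [hlog]
  have hreint : Integrable (fun θ => (G B θ).re) ν := ((G B).integrable ν).re
  rw [integral_add hlogint hreint, neg_add, hre]
  rfl

theorem theorem1 (d : ℕ) (hd : 2 ≤ d) (p : Fin d → ℝ) (hp : ∀ j, 0 < p j) (hsum : ∑ j, p j = 1)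
    (A : Fin (d - 1) → ℂ) (hA : A ∈ paramSpace d) :
    (∀ᶠ B in 𝓝 A, B ∈ paramSpace d) ∧
    (∃! μ : Measure ℂ, IsWeightedLyubichMeasure d (centredPoly d A) p μ) ∧
    weightedLyubichMeasure d (centredPoly d A) p (juliaSet (centredPoly d A))ᶜ = 0 ∧
    IntegrableOn (fun z => Real.log ‖(centredPoly d A).derivative.eval z‖)
      (juliaSet (centredPoly d A)) (weightedLyubichMeasure d (centredPoly d A) p) ∧
    ContDiffAt ℝ 2 (lyapunovFun d p) A ∧
    ∀ r s : Fin (d - 1),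
      partialRe r (partialRe s (lyapunovFun d p)) A =
        -partialIm r (partialIm s (lyapunovFun d p)) A := by
  have hp0 : ∀ j, 0 ≤ p j := fun j => (hp j).le
  obtain ⟨ν, _, hν⟩ := exists_limit_wordAverage hd hp0 hsum
  obtain ⟨Psi, hPsi⟩ := exists_isBoettcherParam hd hA
  have hm := hPsi.isWeightedLyubichMeasure_map hp0 hν
  obtain ⟨g, c, hg, hF⟩ := exists_lyapunovFun_eventuallyEq_re hd hp0 hA hν (n := 2) (by simp)
  have := hm.1
  rw [hPsi.weightedLyubichMeasure_eq hd hp0 hA.2.2 hν]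
  exact ⟨eventually_mem_paramSpace hd hA, ⟨_, hm, fun μ hμ => hμ.unique hd hp0 hA.2.2 hm⟩,
    map_comp_circlePt_compl_juliaSet hd hA hPsi ν, integrableOn_log_derivative hd hA _,
    contDiffAt_real_of_eventuallyEq_re hF hg,
    partialRe_partialRe_eq_neg_of_eventuallyEq_re hF hg⟩
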